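/- **Setting.** For $c\in\mathbb C\setminus\big([-1,0)\cup(0,1]\big)$ let $Q(\eta)=\dfrac{\sin\eta}{c+\sin\eta}$ (so $Q\equiv 1$ if $c=0$), with Fourier coefficients $g_k=\frac1{2\pi}\int_0^{2\pi}Q(\eta)e^{-ik\eta}\,d\eta$, and put $\tilde g_0=0$, $\tilde g_k=g_k$ for $k\neq0$. The Hill determinant is $$D(\Lambda)=\lim_{N\to\infty}\det\Big(\frac{\tilde g_{n-m}}{\Lambda-n^2}+\delta_{n,m}\Big)_{-N\le n,m\le N},\qquad \Lambda\in\mathbb C\setminus\{n^2:n\in\mathbb Z\}.$$ For real $\theta,d$ define $$E(c;\theta,d)=-2+2\cos(2\pi\theta)+4\,D(g_0-d^2)\,\sin^2\!\big(\pi\sqrt{g_0-d^2}\big),$$ where, if $g_0-d^2$ is the square of an integer, the product $D(\Lambda)\sin^2(\pi\sqrt\Lambda)$ is replaced by its limit as $\Lambda\to g_0-d^2$ (with the $g_k$ fixed). The separated ODE with parameters $(\theta,d)$ is $$f''+2i\theta f'+\big(Q(\eta)-\theta^2-d^2\big)f=0,\qquad f(\eta+2\pi)=f(\eta);$$ $c$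 is an eigenvalue if there is a nonzero $C^2$ solution $f:\mathbb R\to\mathbb C$. A discrete eigenvalue is an eigenvalue $c\notin[-1,1]$ (the interval $[-1,1]$ is the continuous spectrum) with a punctured neighbourhood that contains no eigenvalue. **Theorem.** The limit defining $D(\Lambda)$ exists for every $\Lambda\notin\{n^2:n\in\mathbb Z\}$, and so does the limit of $D(\Lambda)\sin^2(\pi\sqrt\Lambda)$ at each $n^2$. For all real $\theta,d$, the function $E(\cdot\,;\theta,d)$ is an Evans function for the separated ODE: 1. $c\mapsto E(c;\theta,d)$ is holomorphic on $\mathbb C\setminus[-1,1]$. 2. For every $c\in\mathbb C\setminus\big([-1,0)\cup(0,1]\big)$, $E(c;\theta,d)=0$ if and only if $c$ is an eigenvalue of the separated ODE with parameters $(\theta,d)$. 3. If $(\theta,d)\notin\mathbb Z\times\{0\}$, then for every $c\in\mathbb C\setminus[-1,1]$, $E(c;\theta,d)=0$ if and only if $c$ is a discrete eigenvalue of the separated ODE with parameters $(\theta,d)$. In particular, let $\mathbf p,\mathbf q\in\mathbb Z^2$ with $p_2q_1-p_1q_2=1$, $p^2=|\mathbf p|^2$, $q^2=|\mathbf q|^2$,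 $\psi(\eta)=\cos\eta$, let $k\ne0$ be an integer, and let $\lambda\in\mathbb C$ with $i\lambda/k\notin[-1,1]$. Then $$E\Big(\frac{i\lambda}{k};\,\frac{k\,\mathbf p\cdot\mathbf q}{p^2},\,\frac{k}{p^2}\Big)=0$$ if and only if $\lambda$ is an isolated element of the set of those $\lambda$ for which $$f''+\frac{2ik\,\mathbf p\cdot\mathbf q}{p^2}f'+\Big(\frac{k\psi'''(\eta)}{i\lambda-k\psi'(\eta)}-\frac{k^2q^2}{p^2}\Big)f=0$$ has a nonzero $2\pi$-periodic $C^2$ solution. (Where a quotient $\sin\eta/(c+\sin\eta)$ has a vanishing denominator, the equation is not required at that $\eta$.) -/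

import Mathlib

open Filter Topology

noncomputable section

namespace EulerHill

/-- The interval `[-1, 1]` of the complex plane, which is the continuous spectrum. -/
def contSpectrum : Set ℂ := (fun x : ℝ => (x : ℂ)) '' Set.Icc (-1 : ℝ) 1

/-! ### The separated ODE and its eigenvalues -/

/-- The potential `Q(η) = sin η / (c + sin η)`. -/
def potential (c : ℂ) (η : ℝ) : ℂ := (Real.sin η : ℂ) / (c + (Real.sin η : ℂ))

/-- The separated ODE with parameters `(θ, d)`:
`f'' + 2 i θ f' + (sin η / (c + sin η) - (θ² + d²)) f = 0`,
for a `2π`-periodic `f` of class `C²`. For `c ∉ [-1, 1]` the equation is required at every `η`;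
for `c = 0` the points with `sin η = 0`, where the quotient has no value, are left out
(by continuity the equation with `Q = 1` then holds there too). -/
def IsModeSolution (θ d : ℝ) (c : ℂ) (f : ℝ → ℂ) : Prop :=
  ContDiff ℝ 2 f ∧ (∀ η : ℝ, f (η + 2 * Real.pi) = f η) ∧
    ∀ η : ℝ, c + (Real.sin η : ℂ) ≠ 0 →
      iteratedDeriv 2 f η + 2 * Complex.I * (θ : ℂ) * deriv f η
        + (potential c η - ((θ : ℂ) ^ 2 + (d : ℂ) ^ 2)) * f η = 0

/-- The eigenvalues `c` of the separated ODE with parameters `(θ, d)`. -/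
def modeEigenvalues (θ d : ℝ) : Set ℂ :=
  {c | ∃ f : ℝ → ℂ, f ≠ 0 ∧ IsModeSolution θ d c f}

/-- The separated ODE in its original form, for the linearisation of the Euler equations about
the stream function `ψ(p₁ x + p₂ y)`, for the mode `f(η) exp(i k ξ + λ t)` with
`ξ = q₁ x + q₂ y` and `η = p₁ x + p₂ y`. -/
def IsSeparatedSolution (ψ : ℝ → ℝ) (p₁ p₂ q₁ q₂ k : ℤ) (lam : ℂ) (f : ℝ → ℂ) : Prop :=
  ContDiff ℝ 2 f ∧ (∀ η : ℝ, f (η + 2 * Real.pi) = f η) ∧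
    ∀ η : ℝ, Complex.I * lam - (k : ℂ) * ((deriv ψ η : ℝ) : ℂ) ≠ 0 →
      iteratedDeriv 2 f η
        + (2 * Complex.I * (k : ℂ) * ((p₁ : ℂ) * q₁ + (p₂ : ℂ) * q₂)
            / ((p₁ : ℂ) ^ 2 + (p₂ : ℂ) ^ 2)) * deriv f η
        + ((k : ℂ) * ((iteratedDeriv 3 ψ η : ℝ) : ℂ) / (Complex.I * lam - (k : ℂ) * ((deriv ψ η : ℝ) : ℂ))
            - (k : ℂ) ^ 2 * ((q₁ : ℂ) ^ 2 + (q₂ : ℂ) ^ 2) / ((p₁ : ℂ) ^ 2 + (p₂ : ℂ) ^ 2)) * f η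
        = 0

/-- The temporal eigenvalues `λ` of the separated ODE in its original form. -/
def separatedEigenvalues (ψ : ℝ → ℝ) (p₁ p₂ q₁ q₂ k : ℤ) : Set ℂ :=
  {lam | ∃ f : ℝ → ℂ, f ≠ 0 ∧ IsSeparatedSolution ψ p₁ p₂ q₁ q₂ k lam f}

/-- `z` is an isolated point of the set `S`. -/
def IsIsolatedPoint (S : Set ℂ) (z : ℂ) : Prop :=
  z ∈ S ∧ ∀ᶠ w in 𝓝[≠] z, w ∉ S

/-- Discrete eigenvalues `c` of the separated ODE with parameters `(θ, d)`: isolated eigenvalues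
outside the continuous spectrum. -/
def IsDiscreteEigenvalue (θ d : ℝ) (c : ℂ) : Prop :=
  c ∉ contSpectrum ∧ IsIsolatedPoint (modeEigenvalues θ d) c

/-! ### The Hill determinant -/

/-- The Fourier coefficients `g_k` of the potential `Q`. -/
def coeff (c : ℂ) (k : ℤ) : ℂ :=
  (1 / (2 * (Real.pi : ℂ))) *
    ∫ η in (0 : ℝ)..(2 * Real.pi), potential c η * Complex.exp (-(Complex.I * (k : ℂ) * (η : ℂ)))

/-- The Fourier coefficients of `Q - g₀`. -/
def coeffOff (c : ℂ) (k : ℤ) : ℂ := if k = 0 then 0 else coeff c k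

/-- The truncation of Hill's matrix to indices `-N ≤ n, m ≤ N`. -/
def hillMatrix (c Λ : ℂ) (N : ℕ) :
    Matrix (Finset.Icc (-(N : ℤ)) (N : ℤ)) (Finset.Icc (-(N : ℤ)) (N : ℤ)) ℂ :=
  Matrix.of fun n m =>
    coeffOff c ((n : ℤ) - (m : ℤ)) / (Λ - ((n : ℤ) : ℂ) ^ 2) + (if n = m then 1 else 0)

/-- The Hill determinant `D(Λ)`, the limit of its truncations. -/
def hillDet (c Λ : ℂ) : ℂ := limUnder atTop fun N : ℕ => (hillMatrix c Λ N).det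

/-- The squares of integers, where the entries of Hill's matrix have a zero denominator. -/
def squares : Set ℂ := {Λ | ∃ n : ℤ, Λ = (n : ℂ) ^ 2}

/-- `D(Λ) sin²(π √Λ)`; the principal root is used, and the value does not depend on the root. -/
def rawProduct (c Λ : ℂ) : ℂ :=
  hillDet c Λ * Complex.sin ((Real.pi : ℂ) * Λ ^ (1 / 2 : ℂ)) ^ 2

open scoped Classical in
/-- `D(Λ) sin²(π √Λ)` with the removable singularities at the squares filled in. -/
def hillProduct (c Λ : ℂ) : ℂ :=
  if Λ ∈ squares then limUnder (𝓝[≠] Λ) (rawProduct c) else rawProduct c Λ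

/-- `E(c; θ, d) = -2 + 2 cos(2πθ) + 4 D(g₀ - d²) sin²(π √(g₀ - d²))`. -/
def evans (c : ℂ) (θ d : ℝ) : ℂ :=
  -2 + 2 * (Real.cos (2 * Real.pi * θ) : ℂ) + 4 * hillProduct c (coeff c 0 - (d : ℂ) ^ 2)

end EulerHill

end

/-!
# The Evans function of the separated linearised Euler equations from Hill's determinant

Write `a` for the Fourier coefficients of `Q - d²`. The function `f = ∑ xₙ exp (inη)` solves the
separated equation with parameter `θ` exactly when `∑ₘ a (n - m) xₘ = (n + θ)² xₙ` for all `n`.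
This system makes sense for complex `θ`, and the point is to study its determinant as a function of
the Floquet exponent `μ` in place of `θ`. No monodromy matrix and no theory of linear differential
equations is needed: everything happens on the side of the infinite determinant.

*Infinite determinants.* If `∑ |K n m| < ∞`, the truncations of `det (1 + K)` converge
(`tendsto_truncDet`), holomorphically in parameters (`differentiableOn_infDet`), and the limit
vanishes exactly when `1 + K` has a null vector in `ℓ¹` (`infDet_eq_zero_iff`). For the harder
direction, the Fredholm alternative bounds `1 + K` below on `ℓ¹` if there is no null vector, hence
also its large truncations, and then their inverses have determinants of bounded size.

*The dependence on the Floquet exponent.* Dividing row `n` of the system by `z² - (n + μ)²` gives a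
matrix `1 + K` of this kind, and by Euler's product for the sine the function
`G(μ) = sin π(z - μ) sin π(z + μ) det (1 + K)` does not depend on `z`
(`sin_mul_sin_mul_infDet_eq`). As `z` is free, `G` has no poles. It is entire and has period `1`,
and taking `z = 0` shows that `G(μ) + sin² πμ` is `o(exp (2π |Im μ|))` away from the real axis.
A Liouville argument in the variable `exp (2πiμ)` gives `G(μ) = G(0) - sin² πμ`
(`hillFun_eq_sub_sin_sq`).

*The Evans function.* With `z = √Λ` and `μ = 0`, `G(0) = D(Λ) sin² π√Λ`; with `z = i` the same
function is seen to be entire in `Λ`, so the singularities at the squares are removable. Hence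
`E(c; θ, d) = 4 G(θ)` (`evans_eq`), which vanishes exactly when the separated equation has a nonzero
periodic solution, and is holomorphic in `c` because the Fourier coefficients of `Q` are, with
quadratic decay that is locally uniform in `c`. Far from `[-1, 1]` the potential is too small for an
eigenvalue unless `d = 0` and `θ` is an integer, so in all other cases `E` is not identically zero
on the connected set `ℂ \ [-1, 1]` and its zeros are isolated.
-/


noncomputable section

namespace EulerHill

/-! ### Estimates for determinants of finite matrices -/

section FiniteMatrix

variable {n : Type*} [Fintype n] [DecidableEq n]

/-- The `ℓ¹` form of Hadamard's inequality. -/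
theorem norm_det_le_prod_sum (A : Matrix n n ℂ) : ‖A.det‖ ≤ ∏ i, ∑ j, ‖A i j‖ := by
  rw [← Matrix.det_transpose, Matrix.det_apply, Finset.prod_univ_sum]
  calc ‖∑ σ : Equiv.Perm n, Equiv.Perm.sign σ • ∏ i, A.transpose (σ i) i‖
      ≤ ∑ σ : Equiv.Perm n, ∏ i, ‖A i (σ i)‖ := by
        refine norm_sum_le_of_le _ fun σ _ => ?_
        rw [Units.smul_def, zsmul_eq_mul, norm_mul, norm_prod]
        rcases Int.units_eq_one_or (Equiv.Perm.sign σ) with h | h <;> simp [h]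
    _ = ∑ f ∈ Finset.univ.image (fun σ : Equiv.Perm n => (σ : n → n)), ∏ i, ‖A i (f i)‖ := by
        rw [Finset.sum_image]
        intro a _ b _ h
        exact DFunLike.coe_injective h
    _ ≤ _ := by
        refine Finset.sum_le_sum_of_subset_of_nonneg ?_ ?_
        · intro f _
          simp
        · intro f _ _
          exact Finset.prod_nonneg fun i _ => norm_nonneg _

theorem sum_norm_one_add_row_le (A : Matrix n n ℂ) (i : n) :
    ∑ j, ‖(1 + A) i j‖ ≤ Real.exp (∑ j, ‖A i j‖) := by
  calc ∑ j, ‖(1 + A) i j‖ ≤ ∑ j, (‖(1 : Matrix n n ℂ) i j‖ + ‖A i j‖) :=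
        Finset.sum_le_sum fun j _ => norm_add_le _ _
    _ = (∑ j, ‖A i j‖) + 1 := by
        rw [Finset.sum_add_distrib, add_comm]
        congr 1
        simp [Matrix.one_apply, apply_ite]
    _ ≤ _ := Real.add_one_le_exp _

theorem norm_det_one_add_le (A : Matrix n n ℂ) :
    ‖(1 + A).det‖ ≤ Real.exp (∑ i, ∑ j, ‖A i j‖) := by
  refine (norm_det_le_prod_sum _).trans ?_
  rw [Real.exp_sum]
  exact Finset.prod_le_prod (fun i _ => Finset.sum_nonneg fun j _ => norm_nonneg _)
    fun i _ => sum_norm_one_add_row_le A i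

/-- A determinant one of whose rows has been replaced is small when the new row is small. -/
theorem norm_det_updateRow_le (M : Matrix n n ℂ) (β : n → ℝ) (hβ : ∀ k, 0 ≤ β k)
    (hM : ∀ k, ∑ j, ‖M k j‖ ≤ Real.exp (β k)) (i : n) (v : n → ℂ) :
    ‖(M.updateRow i v).det‖ ≤ (∑ j, ‖v j‖) * Real.exp (∑ k, β k) := by
  refine (norm_det_le_prod_sum _).trans ?_
  rw [← Finset.mul_prod_erase _ _ (Finset.mem_univ i), Real.exp_sum,
    ← Finset.mul_prod_erase (f := fun k => Real.exp (β k)) _ (Finset.mem_univ i)]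
  simp only [Matrix.updateRow_self]
  refine mul_le_mul_of_nonneg_left ?_ (Finset.sum_nonneg fun j _ => norm_nonneg _)
  have h1 : ∏ k ∈ Finset.univ.erase i, ∑ j, ‖M.updateRow i v k j‖
      ≤ ∏ k ∈ Finset.univ.erase i, Real.exp (β k) := by
    refine Finset.prod_le_prod (fun i _ => Finset.sum_nonneg fun j _ => norm_nonneg _) ?_
    intro k hk
    rw [Matrix.updateRow_ne (Finset.ne_of_mem_erase hk)]
    exact hM k
  refine h1.trans ?_
  exact le_mul_of_one_le_left (Finset.prod_nonneg fun k _ => (Real.exp_pos _).le)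
    (Real.one_le_exp (hβ i))

/-- The determinant `det (1 + A)` is Lipschitz in `A` for the entrywise `ℓ¹` norm, with a constant
that depends only on the size of the matrices in that norm. -/
theorem norm_det_one_add_sub_le (A B : Matrix n n ℂ) (b : n → n → ℝ)
    (hA : ∀ i j, ‖A i j‖ ≤ b i j) (hB : ∀ i j, ‖B i j‖ ≤ b i j) :
    ‖(1 + A).det - (1 + B).det‖
      ≤ (∑ i, ∑ j, ‖A i j - B i j‖) * Real.exp (∑ i, ∑ j, b i j) := by
  -- the rows of `1 + B` are replaced by those of `1 + A` one at a time
  let M : Finset n → Matrix n n ℂ := fun S =>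
    Matrix.of fun i => if i ∈ S then (1 + A) i else (1 + B) i
  have hb : ∀ i, 0 ≤ ∑ j, b i j := fun i =>
    Finset.sum_nonneg fun j _ => (norm_nonneg _).trans (hA i j)
  have hM : ∀ S k, ∑ j, ‖M S k j‖ ≤ Real.exp (∑ j, b k j) := by
    intro S k
    by_cases hk : k ∈ S
    · simp only [M, Matrix.of_apply, hk, if_true]
      exact (sum_norm_one_add_row_le A k).trans
        (Real.exp_le_exp.2 (Finset.sum_le_sum fun j _ => hA k j))
    · simp only [M, Matrix.of_apply, hk, if_false]
      exact (sum_norm_one_add_row_le B k).trans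
        (Real.exp_le_exp.2 (Finset.sum_le_sum fun j _ => hB k j))
  have key : ∀ S : Finset n, ‖(M S).det - (M ∅).det‖
      ≤ (∑ i ∈ S, ∑ j, ‖A i j - B i j‖) * Real.exp (∑ i, ∑ j, b i j) := by
    intro S
    induction S using Finset.induction_on with
    | empty => simp
    | insert i S hi ih =>
      have h1 : M (insert i S) = (M S).updateRow i ((1 + A) i) := by
        ext k j
        by_cases hk : k = i
        · subst hk; simp [M]
        · simp [M, hk]
      have h2 : M S = (M S).updateRow i ((1 + B) i) := by
        ext k j
        by_cases hk : k = i
        · subst hk; simp [M, hi]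
        · simp [hk]
      have h3 : (M (insert i S)).det - (M S).det
          = ((M S).updateRow i (fun j => A i j - B i j)).det := by
        have h4 : (1 + A) i = (fun j => A i j - B i j) + (1 + B) i := by
          ext j
          simp only [Matrix.add_apply, Pi.add_apply]
          ring
        rw [h1, h4, Matrix.det_updateRow_add, ← h2]
        ring
      rw [Finset.sum_insert hi, add_mul]
      have h5 : (M (insert i S)).det - (M ∅).det
          = ((M (insert i S)).det - (M S).det) + ((M S).det - (M ∅).det) := by ring
      rw [h5]
      refine (norm_add_le _ _).trans (add_le_add ?_ ih)
      rw [h3]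
      exact norm_det_updateRow_le _ _ hb (hM S) i _
  have hu : M Finset.univ = 1 + A := by ext i j; simp [M]
  have he : M ∅ = 1 + B := by ext i j; simp [M]
  simpa [hu, he] using key Finset.univ

theorem norm_adjugate_one_add_le (A : Matrix n n ℂ) (i j : n) :
    ‖(1 + A).adjugate i j‖ ≤ Real.exp (∑ i, ∑ j, ‖A i j‖) := by
  rw [Matrix.adjugate_apply]
  refine (norm_det_updateRow_le (1 + A) (fun k => ∑ j, ‖A k j‖)
    (fun k => Finset.sum_nonneg fun j _ => norm_nonneg _) (sum_norm_one_add_row_le A) j _).trans ?_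
  have : ∑ k, ‖(Pi.single i (1 : ℂ) : n → ℂ) k‖ = 1 := by
    simp [Pi.single_apply, apply_ite]
  rw [this, one_mul]

/-- If `1 + A` is bounded below in `ℓ¹`, then its determinant is bounded away from zero, with a
bound that does not depend on the dimension. -/
theorem one_le_norm_det_mul_exp (A : Matrix n n ℂ) (c : ℝ)
    (h : ∀ v : n → ℂ, ∑ i, ‖v i‖ ≤ c * ∑ i, ‖((1 + A).mulVec v) i‖) :
    1 ≤ ‖(1 + A).det‖ * Real.exp (c * ∑ i, ∑ j, ‖A i j‖) := by
  have hdet : IsUnit (1 + A).det := by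
    rw [isUnit_iff_ne_zero]
    intro h0
    obtain ⟨v, hv, hv0⟩ := Matrix.exists_mulVec_eq_zero_iff.2 h0
    have h1 := h v
    rw [hv0] at h1
    simp only [Pi.zero_apply, norm_zero, Finset.sum_const_zero, mul_zero] at h1
    refine hv (funext fun i => ?_)
    have h2 := (Finset.sum_eq_zero_iff_of_nonneg (fun i _ => norm_nonneg (v i))).1
      (le_antisymm h1 (Finset.sum_nonneg fun i _ => norm_nonneg _)) i (Finset.mem_univ i)
    simpa using h2
  -- the inverse is `1 + L` with `L = -(1 + A)⁻¹ A`, whose columns are controlled by those of `A`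
  set L : Matrix n n ℂ := -((1 + A)⁻¹ * A) with hL
  have hinv : (1 + A)⁻¹ = 1 + L := by
    have h1 : (1 + A)⁻¹ * (1 + A) = 1 := Matrix.nonsing_inv_mul _ hdet
    rw [mul_add, mul_one] at h1
    rw [hL]
    exact eq_sub_of_add_eq h1 |>.trans (sub_eq_add_neg _ _)
  have hcol : ∀ m, ∑ i, ‖L i m‖ ≤ c * ∑ i, ‖A i m‖ := by
    intro m
    have h1 := h (fun i => L i m)
    have h2 : (1 + A).mulVec (fun i => L i m) = fun i => -A i m := by
      have h3 : (1 + A) * L = -A := by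
        rw [hL, mul_neg, Matrix.mul_nonsing_inv_cancel_left _ _ hdet]
      ext i
      have := congrFun (congrFun h3 i) m
      simpa [Matrix.mul_apply, Matrix.mulVec, dotProduct] using this
    rw [h2] at h1
    simpa using h1
  have h1 : ‖(1 + L).det‖ ≤ Real.exp (c * ∑ i, ∑ j, ‖A i j‖) := by
    rw [← Matrix.det_transpose, Matrix.transpose_add, Matrix.transpose_one]
    refine (norm_det_one_add_le _).trans (Real.exp_le_exp.2 ?_)
    rw [Finset.sum_comm (f := fun i j => ‖A i j‖), Finset.mul_sum]
    exact Finset.sum_le_sum fun m _ => hcol m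
  have h2 : (1 + A).det * (1 + L).det = 1 := by
    rw [← Matrix.det_mul, ← hinv, Matrix.mul_nonsing_inv _ hdet, Matrix.det_one]
  calc (1 : ℝ) = ‖(1 + A).det‖ * ‖(1 + L).det‖ := by rw [← norm_mul, h2, norm_one]
    _ ≤ _ := mul_le_mul_of_nonneg_left h1 (norm_nonneg _)

end FiniteMatrix

/-! ### Infinite determinants -/

section InfiniteDeterminant

theorem sum_sum_coe_eq_sum_product {κ M : Type*} [AddCommMonoid M] (f : κ → κ → M)
    (s : Finset κ) :
    ∑ i : s, ∑ j : s, f i j = ∑ p ∈ s ×ˢ s, f p.1 p.2 := by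
  rw [Finset.sum_product, ← Finset.sum_coe_sort s]
  exact Finset.sum_congr rfl fun i _ => Finset.sum_coe_sort s (fun j => f i j)

variable {ι : Type*} [DecidableEq ι]

/-- The determinant of the truncation of the infinite matrix `1 + K` to the indices in `s`. -/
def truncDet (K : ι → ι → ℂ) (s : Finset ι) : ℂ :=
  (1 + Matrix.of fun i j : s => K i j).det

/-- The determinant of the infinite matrix `1 + K`: the limit of its truncations along the directed
set of all finite sets of indices. -/
def infDet (K : ι → ι → ℂ) : ℂ := limUnder atTop (truncDet K)

/-- Extending a truncation of `K` by zeros does not change the truncated determinant. -/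
theorem truncDet_truncate (K : ι → ι → ℂ) {s t : Finset ι} (hst : s ⊆ t) :
    truncDet (fun i j => if i ∈ s ∧ j ∈ s then K i j else 0) t = truncDet K s := by
  unfold truncDet
  rw [Matrix.twoBlockTriangular_det _ (fun i : t => (i : ι) ∈ s)]
  · have h2 : (Matrix.toSquareBlockProp (1 + Matrix.of fun i j : t =>
        if (i : ι) ∈ s ∧ (j : ι) ∈ s then K i j else 0) (fun i : t => ¬ (i : ι) ∈ s)) = 1 := by
      ext ⟨i, hi⟩ ⟨j, hj⟩
      simp [Matrix.toSquareBlockProp, hi, Matrix.one_apply]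
    rw [h2, Matrix.det_one, mul_one]
    let e : {i : t // (i : ι) ∈ s} ≃ s :=
      { toFun := fun i => ⟨i.1.1, i.2⟩
        invFun := fun i => ⟨⟨i.1, hst i.2⟩, i.2⟩
        left_inv := fun i => rfl
        right_inv := fun i => rfl }
    rw [← Matrix.det_submatrix_equiv_self e]
    congr 1
    ext i j
    change (1 : Matrix t t ℂ) i.1 j.1 + (if (i.1.1 ∈ s ∧ j.1.1 ∈ s) then K i.1 j.1 else 0)
      = (1 : Matrix s s ℂ) (e i) (e j) + K i.1 j.1
    rw [if_pos ⟨i.2, j.2⟩, Matrix.one_apply, Matrix.one_apply]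
    simp only [e.apply_eq_iff_eq, Subtype.coe_inj]
  · intro i hi j hj
    have hij : i ≠ j := by rintro rfl; exact hi hj
    rw [Matrix.add_apply, Matrix.of_apply, Matrix.one_apply_ne hij, zero_add]
    exact if_neg fun h => hi h.1

theorem tendsto_product_self_atTop :
    Tendsto (fun s : Finset ι => s ×ˢ s) atTop atTop := by
  refine tendsto_atTop_atTop.2 fun u => ⟨u.image Prod.fst ∪ u.image Prod.snd, fun s hs p hp => ?_⟩
  rw [Finset.mem_product]
  exact ⟨hs (Finset.mem_union_left _ (Finset.mem_image_of_mem _ hp)),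
    hs (Finset.mem_union_right _ (Finset.mem_image_of_mem _ hp))⟩

/-- The mass of `b` outside `s × s`, times a constant: it bounds the distance between the
truncation to `s` and all later ones. -/
def tailBound (b : ι × ι → ℝ) (s : Finset ι) : ℝ :=
  ((∑' p, b p) - ∑ p ∈ s ×ˢ s, b p) * Real.exp (∑' p, b p)

theorem tendsto_tailBound {b : ι × ι → ℝ} (hb : Summable b) :
    Tendsto (tailBound b) atTop (𝓝 0) := by
  have h := (hb.hasSum.comp tendsto_product_self_atTop).const_sub (∑' p, b p)
  rw [sub_self] at h
  have h2 := h.mul_const (Real.exp (∑' p, b p))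
  rwa [zero_mul] at h2

variable {K : ι → ι → ℂ} {b : ι × ι → ℝ}

theorem norm_truncDet_sub_le (hK : ∀ i j, ‖K i j‖ ≤ b (i, j)) (hb : Summable b)
    {s t : Finset ι} (hst : s ⊆ t) :
    ‖truncDet K t - truncDet K s‖ ≤ tailBound b s := by
  have hb0 : ∀ p, 0 ≤ b p := fun p => (norm_nonneg _).trans (hK p.1 p.2)
  rw [← truncDet_truncate K hst]
  refine (norm_det_one_add_sub_le _ _ (fun i j : t => b (i, j)) (fun i j => hK i j) ?_).trans ?_
  · intro i j
    simp only [Matrix.of_apply]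
    split_ifs
    · exact hK i j
    · simpa using hb0 _
  · rw [sum_sum_coe_eq_sum_product (fun i j => b (i, j)) t]
    simp only [Matrix.of_apply]
    rw [sum_sum_coe_eq_sum_product
      (fun i j => ‖K i j - if i ∈ s ∧ j ∈ s then K i j else 0‖) t]
    have h1 : ∑ p ∈ t ×ˢ t, ‖K p.1 p.2 - if p.1 ∈ s ∧ p.2 ∈ s then K p.1 p.2 else 0‖
        ≤ (∑' p, b p) - ∑ p ∈ s ×ˢ s, b p := by
      rw [le_sub_iff_add_le,
        ← Finset.sum_sdiff (Finset.product_subset_product hst hst)]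
      have h2 : ∑ p ∈ s ×ˢ s, ‖K p.1 p.2 - if p.1 ∈ s ∧ p.2 ∈ s then K p.1 p.2 else 0‖ = 0 :=
        Finset.sum_eq_zero fun p hp => by
          rw [if_pos (Finset.mem_product.1 hp), sub_self, norm_zero]
      rw [h2, add_zero]
      refine le_trans ?_ (hb.sum_le_tsum (t ×ˢ t) fun p _ => hb0 p)
      rw [← Finset.sum_sdiff (f := b) (Finset.product_subset_product hst hst)]
      refine add_le_add (Finset.sum_le_sum fun p hp => ?_) le_rfl
      rw [if_neg fun h => (Finset.mem_sdiff.1 hp).2 (Finset.mem_product.2 h), sub_zero]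
      exact hK _ _
    exact mul_le_mul h1 (Real.exp_le_exp.2 (hb.sum_le_tsum _ fun p _ => hb0 p))
      (Real.exp_pos _).le ((Finset.sum_nonneg fun p _ => norm_nonneg _).trans h1)

/-- Von Koch's theorem: the truncated determinants converge when the entries of `K` are absolutely
summable. -/
theorem tendsto_truncDet (hK : ∀ i j, ‖K i j‖ ≤ b (i, j)) (hb : Summable b) :
    Tendsto (truncDet K) atTop (𝓝 (infDet K)) := by
  have hc : CauchySeq (truncDet K) := by
    refine cauchySeq_of_le_tendsto_0 (fun s => 2 * tailBound b s) (fun s t u hs ht => ?_) ?_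
    · have h1 := norm_truncDet_sub_le hK hb hs
      have h2 := norm_truncDet_sub_le hK hb ht
      rw [← dist_eq_norm] at h1 h2
      have h3 := dist_triangle_right (truncDet K s) (truncDet K t) (truncDet K u)
      linarith
    · simpa using (tendsto_tailBound hb).const_mul 2
  exact hc.tendsto_limUnder

theorem norm_infDet_sub_le (hK : ∀ i j, ‖K i j‖ ≤ b (i, j)) (hb : Summable b) (s : Finset ι) :
    ‖infDet K - truncDet K s‖ ≤ tailBound b s :=
  le_of_tendsto ((tendsto_truncDet hK hb).sub_const _).norm
    ((eventually_ge_atTop s).mono fun _ ht => norm_truncDet_sub_le hK hb ht)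

theorem norm_infDet_sub_one_le (hK : ∀ i j, ‖K i j‖ ≤ b (i, j)) (hb : Summable b) :
    ‖infDet K - 1‖ ≤ (∑' p, b p) * Real.exp (∑' p, b p) := by
  simpa [tailBound, truncDet] using norm_infDet_sub_le hK hb ∅

/-- The infinite determinant depends holomorphically on a parameter when the entries do and are
dominated by a summable family. -/
theorem differentiableOn_infDet {U : Set ℂ} (hU : IsOpen U) {F : ℂ → ι → ι → ℂ}
    (hF : ∀ i j, DifferentiableOn ℂ (fun z => F z i j) U)
    (hb : Summable b) (hFb : ∀ z ∈ U, ∀ i j, ‖F z i j‖ ≤ b (i, j)) :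
    DifferentiableOn ℂ (fun z => infDet (F z)) U := by
  have hlim : TendstoLocallyUniformlyOn (fun (s : Finset ι) z => truncDet (F z) s)
      (fun z => infDet (F z)) atTop U := by
    refine TendstoUniformlyOn.tendstoLocallyUniformlyOn ?_
    rw [Metric.tendstoUniformlyOn_iff]
    intro ε hε
    filter_upwards [(tendsto_tailBound hb).eventually_lt_const hε] with s hs z hz
    rw [dist_eq_norm]
    exact (norm_infDet_sub_le (hFb z hz) hb s).trans_lt hs
  refine hlim.differentiableOn (Eventually.of_forall fun s => ?_) hU
  unfold truncDet
  simp only [Matrix.det_apply]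
  refine DifferentiableOn.fun_sum fun σ _ => ?_
  refine DifferentiableOn.const_smul ?_ _
  refine DifferentiableOn.fun_finsetProd fun i _ => ?_
  simp only [Matrix.add_apply, Matrix.of_apply]
  exact (differentiableOn_const _).add (hF _ _)

/-- Invariance of the infinite determinant under a permutation of the indices. -/
theorem infDet_comp_equiv (e : ι ≃ ι) (hK : ∀ i j, ‖K i j‖ ≤ b (i, j)) (hb : Summable b) :
    infDet (fun i j => K (e i) (e j)) = infDet K := by
  have h1 : ∀ s : Finset ι, truncDet (fun i j => K (e i) (e j)) s
      = truncDet K (s.map e.toEmbedding) := by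
    intro s
    unfold truncDet
    rw [← Matrix.det_submatrix_equiv_self (e.subtypeEquiv (p := (· ∈ s))
      (q := (· ∈ s.map e.toEmbedding)) (fun a => by simp))]
    congr 1
    ext i j
    simp [Matrix.one_apply]
  have h2 : Tendsto (fun s : Finset ι => s.map e.toEmbedding) atTop atTop := by
    refine tendsto_atTop_atTop.2 fun u => ⟨u.map e.symm.toEmbedding, fun s hs x hx => ?_⟩
    rw [Finset.mem_map_equiv]
    exact hs (by simpa using hx)
  refine Tendsto.limUnder_eq ?_
  have h3 := (tendsto_truncDet hK hb).comp h2
  exact h3.congr fun s => (h1 s).symm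

end InfiniteDeterminant

/-! ### Null vectors of infinite matrices -/

section NullVector

theorem sum_sum_norm_le_tsum {κ : Type*} {K : κ → κ → ℂ}
    (hK : Summable fun p : κ × κ => ‖K p.1 p.2‖) (s : Finset κ) :
    ∑ i : s, ∑ j : s, ‖K i j‖ ≤ ∑' p : κ × κ, ‖K p.1 p.2‖ := by
  rw [sum_sum_coe_eq_sum_product (fun i j => ‖K i j‖) s]
  exact hK.sum_le_tsum _ fun p _ => norm_nonneg _

variable {ι : Type*} [DecidableEq ι] {K : ι → ι → ℂ}

/-- Cramer's rule in the limit: a bounded null vector forces the determinant to vanish. -/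
theorem infDet_eq_zero_of_null_vector (hK : Summable fun p : ι × ι => ‖K p.1 p.2‖)
    {x : ι → ℂ} (hx0 : x ≠ 0) (hx : Summable fun i => ‖x i‖)
    (hnull : ∀ i, x i + ∑' j, K i j * x j = 0) : infDet K = 0 := by
  obtain ⟨X, hX⟩ : ∃ X, ∀ i, ‖x i‖ ≤ X :=
    ⟨∑' i, ‖x i‖, fun i => hx.le_tsum i fun j _ => norm_nonneg _⟩
  have hrow : ∀ i, Summable fun j => ‖K i j‖ := fun i => hK.prod_factor i
  have hrowx : ∀ i, Summable fun j => K i j * x j := fun i =>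
    Summable.of_norm_bounded ((hrow i).mul_right X) fun j => by
      rw [norm_mul]
      exact mul_le_mul_of_nonneg_left (hX j) (norm_nonneg _)
  -- the residual of the truncated vector in the truncated system
  let r : Finset ι → ι → ℂ := fun s i => if i ∈ s then x i + ∑ j ∈ s, K i j * x j else 0
  have hr : Tendsto (fun s => ∑' i, ‖r s i‖) atTop (𝓝 0) := by
    have h := tendsto_tsum_of_dominated_convergence (𝓕 := atTop) (f := fun s i => ‖r s i‖)
      (g := fun _ => (0 : ℝ)) (bound := fun i => ‖x i‖ + (∑' j, ‖K i j‖) * X)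
      (hx.add (hK.prod.mul_right X)) ?_ ?_
    · simpa using h
    · intro i
      have h1 : Tendsto (fun s : Finset ι => ‖x i + ∑ j ∈ s, K i j * x j‖) atTop (𝓝 0) := by
        have := ((hrowx i).hasSum.const_add (x i)).norm
        rwa [hnull i, norm_zero] at this
      refine h1.congr' ?_
      filter_upwards [eventually_ge_atTop {i}] with s hs
      have : i ∈ s := hs (Finset.mem_singleton_self i)
      simp [r, this]
    · refine Eventually.of_forall fun s i => ?_
      have hnn : 0 ≤ (∑' j, ‖K i j‖) * X :=
        mul_nonneg (tsum_nonneg fun _ => norm_nonneg _) ((norm_nonneg _).trans (hX i))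
      rw [norm_norm]
      by_cases hi : i ∈ s
      · simp only [r, hi, if_true]
        refine (norm_add_le _ _).trans (add_le_add le_rfl ?_)
        refine (norm_sum_le _ _).trans ?_
        calc ∑ j ∈ s, ‖K i j * x j‖ ≤ ∑ j ∈ s, ‖K i j‖ * X := by
              refine Finset.sum_le_sum fun j _ => ?_
              rw [norm_mul]
              exact mul_le_mul_of_nonneg_left (hX j) (norm_nonneg _)
          _ = (∑ j ∈ s, ‖K i j‖) * X := by rw [Finset.sum_mul]
          _ ≤ _ := mul_le_mul_of_nonneg_right
              ((hrow i).sum_le_tsum _ fun _ _ => norm_nonneg _) ((norm_nonneg _).trans (hX i))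
      · simp only [r, hi, if_false, norm_zero]
        exact add_nonneg (norm_nonneg _) hnn
  obtain ⟨i, hi⟩ := Function.ne_iff.1 hx0
  have hlim : Tendsto (fun s => ‖truncDet K s * x i‖) atTop (𝓝 0) := by
    have h2 := hr.const_mul (Real.exp (∑' p : ι × ι, ‖K p.1 p.2‖))
    rw [mul_zero] at h2
    refine squeeze_zero' (Eventually.of_forall fun s => norm_nonneg _) ?_ h2
    filter_upwards [eventually_ge_atTop {i}] with s hs
    have his : i ∈ s := hs (Finset.mem_singleton_self i)
    set M : Matrix s s ℂ := Matrix.of fun i j : s => K i j with hM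
    have h3 : ∀ k : s, ((1 + M).mulVec fun j => x j) k = r s k := by
      intro k
      have : ∑ j ∈ s, K k j * x j = ∑ j : s, K k j * x j := by
        rw [← Finset.sum_coe_sort s]
      simp only [r, k.2, if_true, this]
      rw [Matrix.add_mulVec, Matrix.one_mulVec]
      simp [Matrix.mulVec, dotProduct, hM]
    have h4 : truncDet K s * x i = ∑ k : s, (1 + M).adjugate ⟨i, his⟩ k * r s k := by
      have h5 : (1 + M).adjugate.mulVec ((1 + M).mulVec fun j => x j)
          = (1 + M).det • fun j : s => x j := by
        rw [Matrix.mulVec_mulVec, Matrix.adjugate_mul, Matrix.smul_mulVec, Matrix.one_mulVec]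
      have h6 := congrFun h5 ⟨i, his⟩
      simp only [Pi.smul_apply, smul_eq_mul] at h6
      rw [show truncDet K s = (1 + M).det from rfl, ← h6]
      exact Finset.sum_congr rfl fun k _ => by rw [h3 k]
    rw [h4]
    refine (norm_sum_le _ _).trans ?_
    have h7 : ∑ k : s, ‖r s k‖ = ∑' i, ‖r s i‖ := by
      rw [Finset.sum_coe_sort s (fun k => ‖r s k‖), tsum_eq_sum]
      intro k hk
      simp [r, hk]
    rw [← h7, Finset.mul_sum]
    refine Finset.sum_le_sum fun k _ => ?_
    rw [norm_mul]
    refine mul_le_mul_of_nonneg_right ((norm_adjugate_one_add_le M _ _).trans ?_) (norm_nonneg _)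
    exact Real.exp_le_exp.2 (sum_sum_norm_le_tsum hK s)
  have hlim2 := ((tendsto_truncDet (K := K) (b := fun p => ‖K p.1 p.2‖)
    (fun _ _ => le_rfl) hK).mul_const (x i)).norm
  have := tendsto_nhds_unique hlim hlim2
  have h0 : infDet K * x i = 0 := norm_eq_zero.1 this.symm
  exact (mul_eq_zero.1 h0).resolve_right hi

/-- The space `ℓ¹(ι)`. -/
abbrev SeqSpace (ι : Type*) := lp (fun _ : ι => ℂ) 1

/-- The matrix unit at `p` as an operator on `ℓ¹`. -/
def matrixUnit (p : ι × ι) : SeqSpace ι →L[ℂ] SeqSpace ι :=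
  (lp.singleContinuousLinearMap ℂ (fun _ : ι => ℂ) 1 p.1) ∘L (lp.evalCLM ℂ (fun _ : ι => ℂ) 1 p.2)

theorem matrixUnit_apply (p : ι × ι) (x : SeqSpace ι) :
    matrixUnit p x = lp.single 1 p.1 (x p.2) := rfl

theorem norm_matrixUnit_le (p : ι × ι) : ‖matrixUnit p‖ ≤ 1 := by
  refine ContinuousLinearMap.opNorm_le_bound _ zero_le_one fun x => ?_
  rw [matrixUnit_apply, lp.norm_single (by norm_num), one_mul]
  exact lp.norm_apply_le_norm (by norm_num) x p.2

theorem isCompactOperator_matrixUnit (p : ι × ι) : IsCompactOperator (matrixUnit p) := by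
  have h : IsCompactOperator (lp.evalCLM ℂ (fun _ : ι => ℂ) 1 p.2) :=
    isCompactOperator_of_locallyCompactSpace_dom (lp.evalCLM ℂ (fun _ : ι => ℂ) 1 p.2)
  exact h.clm_comp (lp.singleContinuousLinearMap ℂ (fun _ : ι => ℂ) 1 p.1)

/-- The operator on `ℓ¹` with matrix `K`, for absolutely summable `K`. -/
def matrixOp (K : ι → ι → ℂ) : SeqSpace ι →L[ℂ] SeqSpace ι :=
  ∑' p : ι × ι, K p.1 p.2 • matrixUnit p

theorem hasSum_matrixOp (hK : Summable fun p : ι × ι => ‖K p.1 p.2‖) :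
    HasSum (fun p : ι × ι => K p.1 p.2 • matrixUnit p) (matrixOp K) := by
  refine (Summable.of_norm_bounded hK fun p => ?_).hasSum
  rw [norm_smul]
  exact mul_le_of_le_one_right (norm_nonneg _) (norm_matrixUnit_le p)

theorem isCompactOperator_matrixOp (hK : Summable fun p : ι × ι => ‖K p.1 p.2‖) :
    IsCompactOperator (matrixOp K) := by
  refine isCompactOperator_of_tendsto (hasSum_matrixOp hK) (Eventually.of_forall fun s => ?_)
  exact Submodule.sum_mem (compactOperator (RingHom.id ℂ) (SeqSpace ι) (SeqSpace ι))
    fun p _ => Submodule.smul_mem _ _ (isCompactOperator_matrixUnit p)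

theorem matrixOp_apply (hK : Summable fun p : ι × ι => ‖K p.1 p.2‖) (x : SeqSpace ι) (i : ι) :
    matrixOp K x i = ∑' j, K i j * x j := by
  have h1 : HasSum (fun p : ι × ι => K p.1 p.2 * (lp.single 1 p.1 (x p.2) : SeqSpace ι) i)
      (matrixOp K x i) :=
    (hasSum_matrixOp hK).mapL ((lp.evalCLM ℂ (fun _ : ι => ℂ) 1 i) ∘L
      (ContinuousLinearMap.apply ℂ (SeqSpace ι) x))
  have h2 : Function.Injective (fun j : ι => (i, j)) := fun j k h => (Prod.mk.inj h).2
  rw [← h2.hasSum_iff] at h1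
  · rw [← h1.tsum_eq]
    exact tsum_congr fun j => by simp
  · rintro ⟨k, j⟩ hk
    have hki : i ≠ k := by
      rintro rfl
      exact hk ⟨j, rfl⟩
    change K k j * (lp.single 1 k (x j) : SeqSpace ι) i = 0
    rw [lp.single_apply_ne _ _ _ hki, mul_zero]

/-- A vanishing infinite determinant produces a summable null vector. If there were none,
the Fredholm alternative would make `1 + K` bounded below on `ℓ¹`, the same would hold uniformly
for its truncations, and their determinants would stay away from zero. -/
theorem exists_null_vector_of_infDet_eq_zero (hK : Summable fun p : ι × ι => ‖K p.1 p.2‖)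
    (hD : infDet K = 0) :
    ∃ x : ι → ℂ, x ≠ 0 ∧ (Summable fun i => ‖x i‖) ∧ ∀ i, x i + ∑' j, K i j * x j = 0 := by
  by_contra hcon
  have hev : ¬ Module.End.HasEigenvalue (matrixOp K : Module.End ℂ (SeqSpace ι)) (-1) := by
    intro h
    obtain ⟨x, hx⟩ := h.exists_hasEigenvector
    refine hcon ⟨x, ?_, ?_, fun i => ?_⟩
    · intro h0
      exact hx.2 (lp.ext h0)
    · simpa using (lp.memℓp x).summable (by norm_num)
    · have h1 : matrixOp K x = (-1 : ℂ) • x := hx.apply_eq_smul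
      rw [← matrixOp_apply hK, h1]
      simp
  obtain ⟨C, hC⟩ := (isCompactOperator_matrixOp hK).antilipschitz_of_not_hasEigenvalue
    (by norm_num) hev
  have hC1 : ∀ x : SeqSpace ι, ‖x‖ ≤ C * ‖matrixOp K x + x‖ := by
    intro x
    have := hC.le_mul_dist x 0
    simpa [dist_eq_norm] using this
  have hsmall := ((hasSum_matrixOp hK).comp tendsto_product_self_atTop).sub_const (matrixOp K)
  rw [sub_self] at hsmall
  have hsmall2 := hsmall.norm.const_mul (C : ℝ)
  rw [norm_zero, mul_zero] at hsmall2
  have hlow : ∀ᶠ s in atTop, Real.exp (-(2 * C * ∑' p : ι × ι, ‖K p.1 p.2‖)) ≤ ‖truncDet K s‖ := by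
    filter_upwards [hsmall2.eventually_lt_const (show (0 : ℝ) < 1 / 2 by norm_num)] with s hs
    set T : SeqSpace ι →L[ℂ] SeqSpace ι := ∑ p ∈ s ×ˢ s, K p.1 p.2 • matrixUnit p with hT
    have hs' : C * ‖T - matrixOp K‖ < 1 / 2 := hs
    have hbound : ∀ x : SeqSpace ι, ‖x‖ ≤ 2 * C * ‖T x + x‖ := by
      intro x
      have h1 := hC1 x
      have h2 : matrixOp K x + x = (T x + x) - (T - matrixOp K) x := by
        rw [_root_.sub_apply]; abel
      have h3 : ‖matrixOp K x + x‖ ≤ ‖T x + x‖ + ‖T - matrixOp K‖ * ‖x‖ := by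
        rw [h2]
        exact (norm_sub_le _ _).trans (add_le_add le_rfl (ContinuousLinearMap.le_opNorm _ _))
      have h4 : (C : ℝ) * ‖matrixOp K x + x‖ ≤ C * (‖T x + x‖ + ‖T - matrixOp K‖ * ‖x‖) :=
        mul_le_mul_of_nonneg_left h3 C.2
      have h5 : C * ‖T - matrixOp K‖ * ‖x‖ ≤ 1 / 2 * ‖x‖ :=
        mul_le_mul_of_nonneg_right hs'.le (norm_nonneg _)
      nlinarith
    have hfin := one_le_norm_det_mul_exp (Matrix.of fun i j : s => K i j) (2 * C) ?_
    · have h6 : Real.exp (2 * C * ∑ i : s, ∑ j : s, ‖K i j‖)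
          ≤ Real.exp (2 * C * ∑' p : ι × ι, ‖K p.1 p.2‖) :=
        Real.exp_le_exp.2 (mul_le_mul_of_nonneg_left (sum_sum_norm_le_tsum hK s)
          (mul_nonneg zero_le_two C.2))
      have h7 : 1 ≤ ‖truncDet K s‖ * Real.exp (2 * C * ∑' p : ι × ι, ‖K p.1 p.2‖) :=
        hfin.trans (mul_le_mul_of_nonneg_left h6 (norm_nonneg _))
      rw [Real.exp_neg, inv_le_iff_one_le_mul₀ (Real.exp_pos _)]
      exact h7
    · intro v
      -- the vector `v`, extended by zero
      let emb : (s → ℂ) → SeqSpace ι := fun v =>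
        ∑ i ∈ s, lp.single 1 i (if h : i ∈ s then v ⟨i, h⟩ else 0)
      have hemb_norm : ∀ v : s → ℂ, ‖emb v‖ = ∑ i, ‖v i‖ := by
        intro v
        have h1 := lp.norm_sum_single (E := fun _ : ι => ℂ) (p := 1) (by norm_num)
          (fun i => if h : i ∈ s then v ⟨i, h⟩ else 0) s
        simp only [ENNReal.toReal_one, Real.rpow_one] at h1
        rw [show ‖emb v‖ = _ from h1, ← Finset.sum_coe_sort s]
        exact Finset.sum_congr rfl fun i _ => by simp
      have hemb_apply : ∀ (v : s → ℂ) (j : ι), emb v j = if h : j ∈ s then v ⟨j, h⟩ else 0 := by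
        intro v j
        simp only [emb]
        rw [lp.coeFn_sum, Finset.sum_apply]
        by_cases hj : j ∈ s
        · rw [Finset.sum_eq_single_of_mem j hj fun k _ hk => lp.single_apply_ne _ _ _ hk.symm,
            lp.single_apply_self]
        · rw [dif_neg hj]
          refine Finset.sum_eq_zero fun k hk => lp.single_apply_ne _ _ _ ?_
          rintro rfl
          exact hj hk
      have hT_emb : T (emb v) + emb v
          = emb ((1 + Matrix.of fun i j : s => K i j).mulVec v) := by
        refine lp.ext (funext fun i => ?_)
        have h1 : T (emb v) i = ∑ p ∈ s ×ˢ s, K p.1 p.2 *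
            (lp.single 1 p.1 (emb v p.2) : SeqSpace ι) i := by
          rw [hT, _root_.sum_apply, lp.coeFn_sum, Finset.sum_apply]
          rfl
        rw [lp.coeFn_add, Pi.add_apply, h1, Finset.sum_product, hemb_apply, hemb_apply]
        by_cases hi : i ∈ s
        · rw [Finset.sum_eq_single_of_mem i hi]
          · simp only [lp.single_apply_self, hi, dif_pos]
            rw [Matrix.add_mulVec, Matrix.one_mulVec, Pi.add_apply, add_comm]
            congr 1
            rw [Matrix.mulVec, dotProduct, ← Finset.sum_coe_sort s]
            exact Finset.sum_congr rfl fun j _ => by simp [hemb_apply]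
          · intro k _ hk
            exact Finset.sum_eq_zero fun j _ => by
              rw [lp.single_apply_ne _ _ _ hk.symm, mul_zero]
        · rw [dif_neg hi, dif_neg hi, add_zero]
          refine Finset.sum_eq_zero fun k hk => Finset.sum_eq_zero fun j _ => ?_
          have hki : i ≠ k := by
            rintro rfl
            exact hi hk
          rw [lp.single_apply_ne _ _ _ hki, mul_zero]
      have := hbound (emb v)
      rwa [hT_emb, hemb_norm, hemb_norm] at this
  have hlim := (tendsto_truncDet (K := K) (b := fun p => ‖K p.1 p.2‖)
    (fun _ _ => le_rfl) hK).norm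
  rw [hD, norm_zero] at hlim
  exact absurd (ge_of_tendsto hlim hlow) (not_le.2 (Real.exp_pos _))

/-- The infinite determinant of `1 + K` vanishes exactly when `1 + K` has a null vector in `ℓ¹`. -/
theorem infDet_eq_zero_iff (hK : Summable fun p : ι × ι => ‖K p.1 p.2‖) :
    infDet K = 0 ↔
      ∃ x : ι → ℂ, x ≠ 0 ∧ (Summable fun i => ‖x i‖) ∧ ∀ i, x i + ∑' j, K i j * x j = 0 :=
  ⟨exists_null_vector_of_infDet_eq_zero hK, fun ⟨_, hx0, hx, hnull⟩ =>
    infDet_eq_zero_of_null_vector hK hx0 hx hnull⟩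

end NullVector

/-! ### A Liouville theorem for periodic functions -/

open Function.Periodic in
/-- An entire function of period `1` that grows more slowly than `exp (2π |Im μ|)` is constant:
as a function of `q = exp (2πiμ)` it is holomorphic on the punctured plane, with singularities at
`0` and at `∞` that are too weak to be poles. -/
theorem apply_eq_apply_zero_of_periodic_of_growth {H : ℂ → ℂ} (hd : Differentiable ℂ H)
    (hp : Function.Periodic H 1)
    (hb : ∀ ε > 0, ∃ R : ℝ, ∀ μ : ℂ, R ≤ |μ.im| → ‖H μ‖ ≤ ε * Real.exp (2 * Real.pi * |μ.im|))
    (μ : ℂ) : H μ = H 0 := by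
  set F : ℂ → ℂ := fun μ => qParam 1 μ * H μ with hF
  have hFd : Differentiable ℂ F := differentiable_qParam.mul hd
  have hFp : Function.Periodic F ((1 : ℝ) : ℂ) := by
    intro μ
    have h1 : qParam 1 (μ + 1) = qParam 1 μ := by
      rw [qParam, qParam, Complex.ofReal_one, div_one, div_one, mul_add, mul_one, Complex.exp_add,
        Complex.exp_two_pi_mul_I, mul_one]
    simp only [hF, Complex.ofReal_one, h1, hp μ]
  have hF0 : Tendsto F (comap Complex.im atTop) (𝓝 0) := by
    rw [Metric.tendsto_nhds]
    intro ε hε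
    obtain ⟨R, hR⟩ := hb (ε / 2) (by positivity)
    have : ∀ᶠ μ in comap Complex.im atTop, max R 0 ≤ Complex.im μ :=
      tendsto_comap.eventually (eventually_ge_atTop (max R 0))
    filter_upwards [this] with μ hμ
    have h0 : 0 ≤ μ.im := (le_max_right _ _).trans hμ
    have h1 := hR μ (((le_max_left _ _).trans hμ).trans (le_abs_self _))
    rw [abs_of_nonneg h0] at h1
    rw [dist_zero_right]
    simp only [hF, norm_mul, norm_qParam]
    calc Real.exp (-2 * Real.pi * μ.im / 1) * ‖H μ‖
        ≤ Real.exp (-2 * Real.pi * μ.im / 1) * (ε / 2 * Real.exp (2 * Real.pi * μ.im)) :=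
          mul_le_mul_of_nonneg_left h1 (Real.exp_pos _).le
      _ = ε / 2 := by
          rw [mul_left_comm, ← Real.exp_add]
          ring_nf
          simp
      _ < ε := by linarith
  set p : ℂ → ℂ := cuspFunction 1 F with hpdef
  have hpq : ∀ μ, p (qParam 1 μ) = F μ := fun μ => eq_cuspFunction one_ne_zero hFp μ
  have hpdiff : Differentiable ℂ p := by
    intro q
    by_cases hq : q = 0
    · rw [hq]
      exact differentiableAt_cuspFunction_zero one_pos hFp
        (Eventually.of_forall fun z => hFd z) (ZeroAtFilter.boundedAtFilter hF0)
    · rw [← qParam_right_inv one_ne_zero hq]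
      exact differentiableAt_cuspFunction one_ne_zero hFp (hFd _)
  have hp0 : p 0 = 0 := cuspFunction_zero_of_zero_at_inf one_pos hF0
  have hdsl : ∀ {f : ℂ → ℂ}, Differentiable ℂ f → Differentiable ℂ (dslope f 0) := by
    intro f hf
    rw [← differentiableOn_univ] at hf ⊢
    exact (Complex.differentiableOn_dslope univ_mem).2 hf
  set p1 : ℂ → ℂ := dslope p 0 with hp1
  have hp1q : ∀ μ, p1 (qParam 1 μ) = H μ := by
    intro μ
    have h0 := qParam_ne_zero (h := 1) μ
    rw [hp1, dslope_of_ne _ h0, slope_def_field, hpq, hp0]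
    simp only [hF, sub_zero]
    exact mul_div_cancel_left₀ _ h0
  set p2 : ℂ → ℂ := dslope p1 0 with hp2
  have hlim : Tendsto p2 (cocompact ℂ) (𝓝 0) := by
    rw [Metric.tendsto_nhds]
    intro ε hε
    obtain ⟨R, hR⟩ := hb (ε / 2) (by positivity)
    have hN : ∀ᶠ q : ℂ in cocompact ℂ,
        max (max 1 (Real.exp (2 * Real.pi * R))) (2 * ‖p1 0‖ / ε + 1) ≤ ‖q‖ :=
      (tendsto_norm_cocompact_atTop).eventually (eventually_ge_atTop _)
    filter_upwards [hN] with q hq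
    have hq1 : 1 ≤ ‖q‖ := ((le_max_left _ _).trans (le_max_left _ _)).trans hq
    have hqR : Real.exp (2 * Real.pi * R) ≤ ‖q‖ :=
      ((le_max_right _ _).trans (le_max_left _ _)).trans hq
    have hqp : 2 * ‖p1 0‖ / ε + 1 ≤ ‖q‖ := (le_max_right _ _).trans hq
    have hqpos : 0 < ‖q‖ := by linarith
    have hq0 : q ≠ 0 := norm_pos_iff.1 hqpos
    set μ := invQParam 1 q with hμ
    have hqμ : qParam 1 μ = q := qParam_right_inv one_ne_zero hq0
    have him : 2 * Real.pi * |μ.im| = Real.log ‖q‖ := by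
      rw [hμ, im_invQParam, abs_mul, abs_of_nonneg (Real.log_nonneg hq1), abs_div, abs_neg,
        abs_one, abs_of_pos (by positivity : (0 : ℝ) < 2 * Real.pi)]
      field_simp
    have hRim : R ≤ |μ.im| := by
      have h1 : 2 * Real.pi * R ≤ Real.log ‖q‖ := (Real.le_log_iff_exp_le hqpos).2 hqR
      rw [← him] at h1
      exact le_of_mul_le_mul_left h1 (by positivity)
    have h2 := hR μ hRim
    rw [him, Real.exp_log hqpos] at h2
    rw [dist_zero_right, hp2, dslope_of_ne _ hq0, slope_def_field, sub_zero, norm_div,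
      div_lt_iff₀ hqpos]
    have h3 : p1 q = H μ := by rw [← hqμ, hp1q]
    rw [h3]
    have h4 : ‖p1 0‖ < ε / 2 * ‖q‖ := by
      have h5 : 2 * ‖p1 0‖ / ε < ‖q‖ := by linarith
      rw [div_lt_iff₀ hε] at h5
      linarith
    calc ‖H μ - p1 0‖ ≤ ‖H μ‖ + ‖p1 0‖ := norm_sub_le _ _
      _ < ε / 2 * ‖q‖ + ε / 2 * ‖q‖ := by linarith
      _ = ε * ‖q‖ := by ring
  have hzero : ∀ q, p2 q = 0 := fun q =>
    (hdsl (hdsl hpdiff)).apply_eq_of_tendsto_cocompact q hlim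
  have hconst : ∀ μ, H μ = p1 0 := by
    intro μ
    have h0 := qParam_ne_zero (h := 1) μ
    have h1 := hzero (qParam 1 μ)
    rw [hp2, dslope_of_ne _ h0, slope_def_field, div_eq_zero_iff, hp1q, sub_zero] at h1
    exact sub_eq_zero.1 (h1.resolve_right h0)
  rw [hconst μ, hconst 0]

/-! ### Hill's infinite matrix -/

/-- The matrix `K` for which `1 + K` is Hill's system for the Floquet exponent `μ`, when the
potential has the Fourier coefficients `a` and row `n` is divided by `z² - (n + μ)²`. The mean value
`a 0` is part of the potential, so the diagonal of `K` carries `a 0 - z²`. -/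
def hillKernel (a : ℤ → ℂ) (z μ : ℂ) (n m : ℤ) : ℂ :=
  (a (n - m) - if n = m then z ^ 2 else 0) / (z ^ 2 - (n + μ) ^ 2)

/-- No row of Hill's system has a vanishing divisor. -/
def NonResonant (z μ : ℂ) : Prop := ∀ n : ℤ, z ^ 2 - (n + μ) ^ 2 ≠ 0

/-- The majorant of the entries of Hill's matrix. -/
def hillMajorant (A w : ℤ → ℝ) (z : ℂ) (p : ℤ × ℤ) : ℝ :=
  (A (p.1 - p.2) + if p.1 - p.2 = 0 then ‖z‖ ^ 2 else 0) * w p.1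

theorem hasSum_hillMajorant {A w : ℤ → ℝ} (hA : Summable A) (hA0 : ∀ k, 0 ≤ A k)
    (hw : Summable w) (hw0 : ∀ n, 0 ≤ w n) (z : ℂ) :
    HasSum (hillMajorant A w z) ((∑' k, A k + ‖z‖ ^ 2) * ∑' n, w n) := by
  let e : ℤ × ℤ ≃ ℤ × ℤ :=
    { toFun := fun p => (p.1 - p.2, p.1)
      invFun := fun p => (p.2, p.2 - p.1)
      left_inv := fun p => by ext <;> simp
      right_inv := fun p => by ext <;> simp }
  have hA' : HasSum (fun k : ℤ => A k + if k = 0 then ‖z‖ ^ 2 else 0) (∑' k, A k + ‖z‖ ^ 2) :=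
    hA.hasSum.add (hasSum_ite_eq 0 _)
  have h0 : ∀ k : ℤ, 0 ≤ A k + if k = 0 then ‖z‖ ^ 2 else 0 := fun k =>
    add_nonneg (hA0 k) (by split_ifs <;> positivity)
  have h1 := hA'.mul hw.hasSum (hA'.summable.mul_of_nonneg hw h0 hw0)
  exact (e.hasSum_iff (f := fun p : ℤ × ℤ =>
    (A p.1 + if p.1 = 0 then ‖z‖ ^ 2 else 0) * w p.2)).2 h1

theorem norm_hillKernel_le {a : ℤ → ℂ} {A w : ℤ → ℝ} (hA : ∀ k, ‖a k‖ ≤ A k) {z μ : ℂ}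
    (hw : ∀ n : ℤ, ‖(z ^ 2 - (n + μ) ^ 2)⁻¹‖ ≤ w n) (n m : ℤ) :
    ‖hillKernel a z μ n m‖ ≤ hillMajorant A w z (n, m) := by
  rw [hillKernel, hillMajorant, div_eq_mul_inv, norm_mul]
  have h1 : ‖a (n - m) - if n = m then z ^ 2 else 0‖
      ≤ A (n - m) + if n - m = 0 then ‖z‖ ^ 2 else 0 := by
    refine (norm_sub_le _ _).trans (add_le_add (hA _) (le_of_eq ?_))
    simp only [sub_eq_zero, apply_ite norm, norm_pow, norm_zero]
  exact mul_le_mul h1 (hw n) (norm_nonneg _) ((norm_nonneg _).trans h1)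

theorem summable_inv_divisor (z μ : ℂ) :
    Summable fun n : ℤ => ‖(z ^ 2 - (n + μ) ^ 2)⁻¹‖ := by
  have h := ((EisensteinSeries.linear_inv_isBigO_right 1 (μ + z)).mul
    (EisensteinSeries.linear_inv_isBigO_right 1 (μ - z))).norm_left
  have h2 : Summable fun n : ℤ => ((n : ℝ)⁻¹ * (n : ℝ)⁻¹) := by
    have := Real.summable_one_div_int_pow.2 (show 1 < 2 by norm_num)
    refine this.congr fun n => ?_
    rw [pow_two, one_div, mul_inv]
  refine (summable_of_isBigO h2 h).congr fun n => ?_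
  rw [← mul_inv, ← norm_neg, ← inv_neg]
  congr 2
  push_cast
  ring

variable {a : ℤ → ℂ}

theorem summable_hillKernel (ha : Summable fun k => ‖a k‖) (z μ : ℂ) :
    Summable fun p : ℤ × ℤ => ‖hillKernel a z μ p.1 p.2‖ :=
  Summable.of_nonneg_of_le (fun _ => norm_nonneg _)
    (fun p => norm_hillKernel_le (fun _ => le_rfl) (fun _ => le_rfl) p.1 p.2)
    (hasSum_hillMajorant ha (fun _ => norm_nonneg _) (summable_inv_divisor z μ)
      (fun _ => norm_nonneg _) z).summable

theorem tendsto_truncDet_hillKernel (ha : Summable fun k => ‖a k‖) (z μ : ℂ) :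
    Tendsto (fun N : ℕ => truncDet (hillKernel a z μ) (Finset.Icc (-(N : ℤ)) N)) atTop
      (𝓝 (infDet (hillKernel a z μ))) :=
  (tendsto_truncDet (b := fun p => ‖hillKernel a z μ p.1 p.2‖) (fun _ _ => le_rfl)
    (summable_hillKernel ha z μ)).comp
    (Finset.tendsto_Icc_neg_atTop_atTop.comp tendsto_natCast_atTop_atTop)

theorem prod_divisor_eq (z μ : ℂ) (N : ℕ) :
    ∏ n ∈ Finset.Icc (-(N : ℤ)) N, (z ^ 2 - ((n : ℂ) + μ) ^ 2)
      = (z - μ) * (z + μ) * ∏ j ∈ Finset.range N,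
        (((z - μ) ^ 2 - ((j : ℂ) + 1) ^ 2) * ((z + μ) ^ 2 - ((j : ℂ) + 1) ^ 2)) := by
  induction N with
  | zero => simp; ring
  | succ N ih =>
    rw [Finset.prod_range_succ, ← mul_assoc, ← ih, Nat.cast_add, Nat.cast_one,
      Finset.Icc_succ_succ, Finset.prod_union (by simp), Finset.prod_pair (by lia)]
    congr 1
    push_cast
    ring

/-- Euler's product for the sine, applied to the diagonal of Hill's matrix. -/
theorem tendsto_prod_divisor (z μ : ℂ) :
    Tendsto (fun N : ℕ => (Real.pi : ℂ) ^ 2 * (∏ j ∈ Finset.range N, (((j : ℂ) + 1) ^ 4)⁻¹) *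
        ∏ n ∈ Finset.Icc (-(N : ℤ)) N, (z ^ 2 - ((n : ℂ) + μ) ^ 2)) atTop
      (𝓝 (Complex.sin (Real.pi * (z - μ)) * Complex.sin (Real.pi * (z + μ)))) := by
  refine ((Complex.tendsto_euler_sin_prod (z - μ)).mul
    (Complex.tendsto_euler_sin_prod (z + μ))).congr fun N => ?_
  rw [prod_divisor_eq]
  have h : ∏ j ∈ Finset.range N, ((1 - (z - μ) ^ 2 / ((j : ℂ) + 1) ^ 2) *
        (1 - (z + μ) ^ 2 / ((j : ℂ) + 1) ^ 2))
      = ∏ j ∈ Finset.range N, ((((j : ℂ) + 1) ^ 4)⁻¹ *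
        (((z - μ) ^ 2 - ((j : ℂ) + 1) ^ 2) * ((z + μ) ^ 2 - ((j : ℂ) + 1) ^ 2))) := by
    refine Finset.prod_congr rfl fun j _ => ?_
    have : (j : ℂ) + 1 ≠ 0 := by exact_mod_cast Nat.succ_ne_zero j
    field_simp
    ring
  rw [Finset.prod_mul_distrib, Finset.prod_mul_distrib] at h
  linear_combination (Real.pi : ℂ) ^ 2 * (z - μ) * (z + μ) * h

/-- Multiplying the rows by their divisors removes the dependence on `z`. -/
theorem truncDet_hillKernel_mul_prod {z μ : ℂ} (h : NonResonant z μ) (s : Finset ℤ) :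
    (∏ n ∈ s, (z ^ 2 - ((n : ℂ) + μ) ^ 2)) * truncDet (hillKernel a z μ) s
      = (Matrix.of fun n m : s =>
          a ((n : ℤ) - m) - if n = m then ((n : ℤ) + μ : ℂ) ^ 2 else 0).det := by
  rw [truncDet, ← Finset.prod_coe_sort s, ← Matrix.det_mul_column]
  congr 1
  ext n m
  simp only [Matrix.of_apply, Matrix.add_apply, Matrix.one_apply, hillKernel]
  have := h n
  by_cases hnm : n = m
  · subst hnm
    simp only [if_true]
    field_simp
    ring
  · have hnm' : (n : ℤ) ≠ m := fun h => hnm (Subtype.ext h)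
    simp only [hnm, hnm', if_false]
    field_simp
    ring

theorem sin_mul_sin_mul_infDet_eq (ha : Summable fun k => ‖a k‖) {z z' μ : ℂ}
    (hz : NonResonant z μ) (hz' : NonResonant z' μ) :
    Complex.sin (Real.pi * (z - μ)) * Complex.sin (Real.pi * (z + μ)) * infDet (hillKernel a z μ)
      = Complex.sin (Real.pi * (z' - μ)) * Complex.sin (Real.pi * (z' + μ)) *
        infDet (hillKernel a z' μ) := by
  refine tendsto_nhds_unique
    ((tendsto_prod_divisor z μ).mul (tendsto_truncDet_hillKernel ha z μ)) ?_
  refine ((tendsto_prod_divisor z' μ).mul (tendsto_truncDet_hillKernel ha z' μ)).congr fun N => ?_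
  rw [mul_assoc _ _ (truncDet (hillKernel a z' μ) _), truncDet_hillKernel_mul_prod hz',
    mul_assoc _ _ (truncDet (hillKernel a z μ) _), truncDet_hillKernel_mul_prod hz]

/-- The regularised Hill determinant for the Floquet exponent `μ`: Hill's determinant times Euler's
product for its divisors. The auxiliary point `z = i(|Im μ| + 1)` avoids all resonances, and the
value does not depend on this choice. -/
def hillFun (a : ℤ → ℂ) (μ : ℂ) : ℂ :=
  let z : ℂ := Complex.I * ((|μ.im| + 1 : ℝ) : ℂ)
  Complex.sin (Real.pi * (z - μ)) * Complex.sin (Real.pi * (z + μ)) * infDet (hillKernel a z μ)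

/-- The zeros `±iρ` of `(iρ)² - w²` have distance at least `1` from the strip `|Im w| ≤ ρ - 1`, and
the function is bounded below there. -/
theorem re_sq_add_one_le_norm {ρ : ℝ} {w : ℂ} (h : |w.im| + 1 ≤ ρ) :
    w.re ^ 2 + 1 ≤ ‖(Complex.I * (ρ : ℂ)) ^ 2 - w ^ 2‖ := by
  have h1 := abs_le.1 (le_sub_iff_add_le.2 h)
  refine abs_le_of_sq_le_sq' ?_ (norm_nonneg _) |>.2
  rw [sq_sub_sq, ← Complex.normSq_eq_norm_sq, Complex.normSq_mul, Complex.normSq_apply,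
    Complex.normSq_apply]
  simp only [Complex.add_re, Complex.sub_re, Complex.add_im, Complex.sub_im, Complex.mul_re,
    Complex.mul_im, Complex.I_re, Complex.I_im, Complex.ofReal_re, Complex.ofReal_im]
  have h2 : w.re ^ 2 + 1 ≤ (0 * ρ - 1 * 0 + w.re) * (0 * ρ - 1 * 0 + w.re)
      + (0 * 0 + 1 * ρ + w.im) * (0 * 0 + 1 * ρ + w.im) := by nlinarith
  have h3 : w.re ^ 2 + 1 ≤ (0 * ρ - 1 * 0 - w.re) * (0 * ρ - 1 * 0 - w.re)
      + (0 * 0 + 1 * ρ - w.im) * (0 * 0 + 1 * ρ - w.im) := by nlinarith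
  have h4 : 0 ≤ w.re ^ 2 + 1 := by positivity
  calc (w.re ^ 2 + 1) ^ 2 = (w.re ^ 2 + 1) * (w.re ^ 2 + 1) := sq _
    _ ≤ _ := mul_le_mul h2 h3 h4 (h4.trans h2)

theorem nonResonant_I_mul {ρ : ℝ} {μ : ℂ} (h : |μ.im| + 1 ≤ ρ) :
    NonResonant (Complex.I * (ρ : ℂ)) μ := by
  intro n h0
  have h1 := re_sq_add_one_le_norm (ρ := ρ) (w := n + μ) (by simpa using h)
  rw [h0, norm_zero] at h1
  nlinarith [sq_nonneg ((n : ℂ) + μ).re]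

theorem hillFun_eq (ha : Summable fun k => ‖a k‖) {z μ : ℂ} (hz : NonResonant z μ) :
    hillFun a μ = Complex.sin (Real.pi * (z - μ)) * Complex.sin (Real.pi * (z + μ)) *
      infDet (hillKernel a z μ) :=
  sin_mul_sin_mul_infDet_eq ha (nonResonant_I_mul le_rfl) hz

theorem summable_inv_sq_add_one (x : ℝ) : Summable fun n : ℤ => ((n + x) ^ 2 + 1 : ℝ)⁻¹ := by
  refine (summable_inv_divisor Complex.I x).congr fun n => ?_
  have : Complex.I ^ 2 - ((n : ℂ) + x) ^ 2 = ((-((n + x) ^ 2 + 1) : ℝ) : ℂ) := by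
    push_cast
    rw [Complex.I_sq]
    ring
  rw [this, ← Complex.ofReal_inv, Complex.norm_real, inv_neg, norm_neg, Real.norm_eq_abs,
    abs_of_nonneg (by positivity)]

/-- Near a given exponent one value of `z` avoids all resonances, with divisors that are bounded below
uniformly. -/
theorem differentiable_hillFun (ha : Summable fun k => ‖a k‖) : Differentiable ℂ (hillFun a) := by
  intro μ₀
  set z : ℂ := Complex.I * ((|μ₀.im| + 2 : ℝ) : ℂ) with hz
  have him : ∀ μ ∈ Metric.ball μ₀ 1, |μ.im| + 1 ≤ |μ₀.im| + 2 := by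
    intro μ hμ
    rw [mem_ball_iff_norm] at hμ
    have h1 := (Complex.abs_im_le_norm (μ - μ₀)).trans hμ.le
    rw [Complex.sub_im] at h1
    have h2 := abs_sub_abs_le_abs_sub μ.im μ₀.im
    linarith
  have hw : ∀ μ ∈ Metric.ball μ₀ 1, ∀ n : ℤ,
      ‖(z ^ 2 - (n + μ) ^ 2)⁻¹‖ ≤ 4 * ((n + μ₀.re) ^ 2 + 1 : ℝ)⁻¹ := by
    intro μ hμ n
    have h1 := re_sq_add_one_le_norm (ρ := |μ₀.im| + 2) (w := n + μ) (by simpa using him μ hμ)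
    rw [mem_ball_iff_norm] at hμ
    have h2 := abs_le.1 ((Complex.abs_re_le_norm (μ - μ₀)).trans hμ.le)
    simp only [Complex.sub_re] at h2
    simp only [Complex.add_re, Complex.intCast_re] at h1
    have h3 : 0 < ‖z ^ 2 - ((n : ℂ) + μ) ^ 2‖ := lt_of_lt_of_le (by positivity) h1
    rw [norm_inv, ← div_eq_mul_inv, inv_le_comm₀ h3 (by positivity), inv_div,
      div_le_iff₀ (by norm_num)]
    refine le_trans ?_ (mul_le_mul_of_nonneg_right h1 (by norm_num))
    nlinarith [sq_nonneg ((n + μ.re : ℝ) + (μ.re - μ₀.re))]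
  have hK : DifferentiableOn ℂ (fun μ => infDet (hillKernel a z μ)) (Metric.ball μ₀ 1) := by
    refine differentiableOn_infDet Metric.isOpen_ball (fun n m => ?_)
      (hasSum_hillMajorant ha (fun _ => norm_nonneg _)
        ((summable_inv_sq_add_one μ₀.re).mul_left 4) (fun n => by positivity) z).summable
      (fun μ hμ n m => norm_hillKernel_le (fun _ => le_rfl) (hw μ hμ) n m)
    unfold hillKernel
    refine DifferentiableOn.div (differentiableOn_const _) (by fun_prop) fun μ hμ => ?_
    exact nonResonant_I_mul (him μ hμ) n
  have heq : hillFun a =ᶠ[𝓝 μ₀] fun μ => Complex.sin (Real.pi * (z - μ)) *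
      Complex.sin (Real.pi * (z + μ)) * infDet (hillKernel a z μ) := by
    filter_upwards [Metric.ball_mem_nhds μ₀ one_pos] with μ hμ
    exact hillFun_eq ha (nonResonant_I_mul (him μ hμ))
  refine DifferentiableAt.congr_of_eventuallyEq ?_ heq
  have hD := hK.differentiableAt (Metric.ball_mem_nhds μ₀ one_pos)
  fun_prop

/-- Replacing `μ` by `μ + 1` shifts the indices of Hill's matrix. -/
theorem periodic_hillFun (ha : Summable fun k => ‖a k‖) :
    Function.Periodic (hillFun a) 1 := by
  intro μ
  set z : ℂ := Complex.I * ((|μ.im| + 1 : ℝ) : ℂ) with hz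
  rw [hillFun_eq ha (z := z) (nonResonant_I_mul (by simp)),
    hillFun_eq ha (z := z) (μ := μ) (nonResonant_I_mul le_rfl)]
  have h1 : infDet (hillKernel a z (μ + 1)) = infDet (hillKernel a z μ) := by
    rw [← infDet_comp_equiv (Equiv.addRight (1 : ℤ))
      (b := fun p => ‖hillKernel a z μ p.1 p.2‖) (fun _ _ => le_rfl) (summable_hillKernel ha z μ)]
    congr 1
    ext n m
    simp only [hillKernel, Equiv.coe_addRight]
    push_cast
    simp only [add_sub_add_right_eq_sub, add_left_inj]
    ring_nf
  rw [h1, show (Real.pi : ℂ) * (z - (μ + 1)) = Real.pi * (z - μ) - Real.pi by ring,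
    show (Real.pi : ℂ) * (z + (μ + 1)) = Real.pi * (z + μ) + Real.pi by ring,
    Complex.sin_sub_pi, Complex.sin_add_pi]
  ring

theorem norm_sin_sq_le (w : ℂ) : ‖Complex.sin w ^ 2‖ ≤ Real.exp (2 * |w.im|) := by
  have h1 : ‖Complex.sin w‖ ≤ Real.exp |w.im| := by
    rw [Complex.sin, norm_div, norm_mul, Complex.norm_I, mul_one, Complex.norm_ofNat]
    have h2 : ‖Complex.exp (-w * Complex.I)‖ ≤ Real.exp |w.im| := by
      rw [Complex.norm_exp]
      exact Real.exp_le_exp.2 (by simpa using le_abs_self w.im)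
    have h3 : ‖Complex.exp (w * Complex.I)‖ ≤ Real.exp |w.im| := by
      rw [Complex.norm_exp]
      exact Real.exp_le_exp.2 (by simpa using neg_le_abs w.im)
    have := norm_sub_le (Complex.exp (-w * Complex.I)) (Complex.exp (w * Complex.I))
    linarith
  rw [norm_pow, two_mul, Real.exp_add, sq]
  exact mul_le_mul h1 h1 (norm_nonneg _) (Real.exp_pos _).le

/-- The dependence of the regularised Hill determinant on the Floquet exponent is explicit. -/
theorem hillFun_eq_sub_sin_sq (ha : Summable fun k => ‖a k‖) (μ : ℂ) :
    hillFun a μ = hillFun a 0 - Complex.sin (Real.pi * μ) ^ 2 := by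
  have hHp : Function.Periodic (fun μ => hillFun a μ + Complex.sin (Real.pi * μ) ^ 2) 1 := by
    intro μ
    simp only
    rw [periodic_hillFun ha μ, mul_add, mul_one, Complex.sin_add_pi, neg_sq]
  have key := apply_eq_apply_zero_of_periodic_of_growth
    (H := fun μ => hillFun a μ + Complex.sin (Real.pi * μ) ^ 2) ?_ hHp ?_ μ
  · simp only [mul_zero, Complex.sin_zero] at key
    linear_combination key
  · have := differentiable_hillFun ha
    fun_prop
  · -- far from the real axis the choice `z = 0` shows that the determinant tends to `1`
    have hη : Tendsto (fun y : ℝ => ∑' n : ℤ, 2 * ((n : ℝ) ^ 2 + y ^ 2)⁻¹) atTop (𝓝 0) := by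
      have h := tendsto_tsum_of_dominated_convergence (𝓕 := atTop)
        (f := fun (y : ℝ) (n : ℤ) => 2 * ((n : ℝ) ^ 2 + y ^ 2)⁻¹)
        (g := fun _ => (0 : ℝ)) (bound := fun n : ℤ => 2 * (((n : ℝ) + (0 : ℝ)) ^ 2 + 1)⁻¹)
        ((summable_inv_sq_add_one 0).mul_left 2) ?_ ?_
      · simpa using h
      · intro n
        have h1 : Tendsto (fun y : ℝ => (n : ℝ) ^ 2 + y ^ 2) atTop atTop :=
          tendsto_atTop_add_const_left _ _ (tendsto_pow_atTop two_ne_zero)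
        simpa using h1.inv_tendsto_atTop.const_mul 2
      · filter_upwards [eventually_ge_atTop 1] with y hy n
        rw [Real.norm_of_nonneg (by positivity), add_zero]
        gcongr
        nlinarith
    set S : ℝ := ∑' k, ‖a k‖ with hS
    have hB : Tendsto (fun y : ℝ => ((S + ‖(0 : ℂ)‖ ^ 2) * ∑' n : ℤ, 2 * ((n : ℝ) ^ 2 + y ^ 2)⁻¹) *
        Real.exp ((S + ‖(0 : ℂ)‖ ^ 2) * ∑' n : ℤ, 2 * ((n : ℝ) ^ 2 + y ^ 2)⁻¹)) atTop (𝓝 0) := by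
      have h1 := hη.const_mul (S + ‖(0 : ℂ)‖ ^ 2)
      have h2 := h1.mul (h1.rexp)
      simpa using h2
    intro ε hε
    obtain ⟨R, hR⟩ :=
      ((hB.eventually_le_const hε).and (eventually_ge_atTop 2)).exists_forall_of_atTop
    refine ⟨R, fun μ hμ => ?_⟩
    -- by periodicity the real part may be taken in `[0, 1]`, where the divisors at `z = 0` are
    -- bounded below uniformly
    obtain ⟨ν, hν0, hν1, hνim, hνH⟩ : ∃ ν : ℂ, 0 ≤ ν.re ∧ ν.re ≤ 1 ∧ ν.im = μ.im ∧
        hillFun a ν + Complex.sin (Real.pi * ν) ^ 2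
          = hillFun a μ + Complex.sin (Real.pi * μ) ^ 2 := by
      refine ⟨μ - ⌊μ.re⌋, ?_, ?_, ?_, ?_⟩
      · simp
      · simpa using (Int.fract_lt_one μ.re).le
      · simp
      · simpa using hHp.sub_int_mul_eq (x := μ) ⌊μ.re⌋
    rw [← hνH, ← hνim]
    rw [← hνim] at hμ
    obtain ⟨h1, h2⟩ := hR _ hμ
    have hw : ∀ n : ℤ, ((n : ℝ) ^ 2 + |ν.im| ^ 2) / 2 ≤ ‖(0 : ℂ) ^ 2 - ((n : ℂ) + ν) ^ 2‖ := by
      intro n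
      rw [zero_pow two_ne_zero, zero_sub, norm_neg, norm_pow, ← Complex.normSq_eq_norm_sq,
        Complex.normSq_apply, sq_abs]
      simp only [Complex.add_re, Complex.add_im, Complex.intCast_re, Complex.intCast_im, zero_add]
      have hy : 2 ^ 2 ≤ ν.im ^ 2 := by
        rw [← sq_abs ν.im]
        gcongr
      have hx : ν.re ^ 2 ≤ 1 := pow_le_one₀ hν0 hν1
      nlinarith [sq_nonneg ((n : ℝ) + 2 * ν.re)]
    have hpos : ∀ n : ℤ, 0 < ((n : ℝ) ^ 2 + |ν.im| ^ 2) / 2 := fun n => by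
      have : 0 < |ν.im| := by linarith
      positivity
    have hnr : NonResonant 0 ν := fun n h0 => by
      have := hw n
      rw [h0, norm_zero] at this
      exact absurd this (not_le.2 (hpos n))
    have hw' : ∀ n : ℤ,
        ‖((0 : ℂ) ^ 2 - ((n : ℂ) + ν) ^ 2)⁻¹‖ ≤ 2 * ((n : ℝ) ^ 2 + |ν.im| ^ 2)⁻¹ := by
      intro n
      rw [norm_inv, ← div_eq_mul_inv, ← inv_div]
      exact inv_anti₀ (hpos n) (hw n)
    have hsum : Summable fun n : ℤ => 2 * ((n : ℝ) ^ 2 + |ν.im| ^ 2)⁻¹ := by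
      refine Summable.of_nonneg_of_le (fun n => by positivity) (fun n => ?_)
        ((summable_inv_sq_add_one 0).mul_left 2)
      rw [add_zero]
      gcongr
      nlinarith
    have hmaj := hasSum_hillMajorant ha (fun _ => norm_nonneg _) hsum
      (fun n => by positivity) (0 : ℂ)
    have hD := norm_infDet_sub_one_le (norm_hillKernel_le (a := a) (fun _ => le_rfl) hw')
      hmaj.summable
    rw [hmaj.tsum_eq] at hD
    have hH : hillFun a ν + Complex.sin (Real.pi * ν) ^ 2
        = -(infDet (hillKernel a 0 ν) - 1) * Complex.sin (Real.pi * ν) ^ 2 := by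
      rw [hillFun_eq ha hnr, zero_sub, zero_add, mul_neg, Complex.sin_neg]
      ring
    rw [hH, norm_mul, norm_neg]
    refine mul_le_mul (hD.trans h1) ((norm_sin_sq_le _).trans (le_of_eq ?_)) (norm_nonneg _) hε.le
    rw [Complex.im_ofReal_mul, abs_mul, abs_of_pos Real.pi_pos, mul_assoc]

/-! ### Fourier coefficients and absolutely convergent Fourier series -/

/-- The Fourier coefficients of a `2π`-periodic function, normalised as for `coeff`. -/
def fourierCoef (h : ℝ → ℂ) (k : ℤ) : ℂ :=
  (1 / (2 * (Real.pi : ℂ))) *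
    ∫ η in (0 : ℝ)..(2 * Real.pi), h η * Complex.exp (-(Complex.I * (k : ℂ) * (η : ℂ)))

/-- The sum of the Fourier series with coefficients `x`. -/
def trigSum (x : ℤ → ℂ) (η : ℝ) : ℂ := ∑' k : ℤ, x k * Complex.exp (Complex.I * (k : ℂ) * (η : ℂ))

theorem norm_exp_I_mul_int_mul (k : ℤ) (η : ℝ) :
    ‖Complex.exp (Complex.I * (k : ℂ) * (η : ℂ))‖ = 1 := by
  rw [Complex.norm_exp]
  simp

theorem norm_exp_neg_I_mul_int_mul (k : ℤ) (η : ℝ) :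
    ‖Complex.exp (-(Complex.I * (k : ℂ) * (η : ℂ)))‖ = 1 := by
  rw [Complex.norm_exp]
  simp

theorem exp_I_mul_int_mul_periodic (k : ℤ) (η : ℝ) :
    Complex.exp (Complex.I * (k : ℂ) * ((η + 2 * Real.pi : ℝ) : ℂ))
      = Complex.exp (Complex.I * (k : ℂ) * (η : ℂ)) := by
  rw [← Complex.exp_periodic.int_mul k (Complex.I * (k : ℂ) * (η : ℂ))]
  congr 1
  push_cast
  ring

theorem norm_fourierCoef_le {h : ℝ → ℂ} {M : ℝ} (hM : ∀ η, ‖h η‖ ≤ M) (k : ℤ) :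
    ‖fourierCoef h k‖ ≤ M := by
  have h1 := intervalIntegral.norm_integral_le_of_norm_le_const (a := 0) (b := 2 * Real.pi)
    (f := fun η : ℝ => h η * Complex.exp (-(Complex.I * (k : ℂ) * (η : ℂ)))) (C := M)
    (fun η _ => by rw [norm_mul, norm_exp_neg_I_mul_int_mul, mul_one]; exact hM η)
  rw [sub_zero, abs_of_pos Real.two_pi_pos] at h1
  rw [fourierCoef, norm_mul]
  have h2 : ‖1 / (2 * (Real.pi : ℂ))‖ = (2 * Real.pi)⁻¹ := by
    rw [norm_div, norm_one, norm_mul, Complex.norm_ofNat, Complex.norm_real,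
      Real.norm_of_nonneg Real.pi_pos.le, one_div]
  rw [h2, inv_mul_le_iff₀ Real.two_pi_pos, mul_comm _ M]
  exact h1

theorem fourierCoef_deriv {h h' : ℝ → ℂ} (hd : ∀ η, HasDerivAt h (h' η) η)
    (hc : Continuous h') (hp : ∀ η, h (η + 2 * Real.pi) = h η) (k : ℤ) :
    fourierCoef h' k = Complex.I * k * fourierCoef h k := by
  have hv : ∀ η : ℝ, HasDerivAt (fun η : ℝ => Complex.exp (-(Complex.I * (k : ℂ) * (η : ℂ))))
      (Complex.exp (-(Complex.I * (k : ℂ) * (η : ℂ))) * -(Complex.I * k)) η := by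
    intro η
    have h1 : HasDerivAt (fun η : ℝ => -(Complex.I * (k : ℂ) * (η : ℂ))) (-(Complex.I * k * 1)) η :=
      (Complex.ofRealCLM.hasDerivAt (x := η)).const_mul (Complex.I * k) |>.neg
    rw [mul_one] at h1
    exact h1.cexp
  have hhc : Continuous h := continuous_iff_continuousAt.2 fun η => (hd η).continuousAt
  have hibp := intervalIntegral.integral_mul_deriv_eq_deriv_mul (a := 0) (b := 2 * Real.pi)
    (fun η _ => hd η) (fun η _ => hv η) (hc.intervalIntegrable _ _)
    (Continuous.intervalIntegrable (by fun_prop) _ _)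
  have hb : h (2 * Real.pi) = h 0 := by simpa using hp 0
  have he := exp_I_mul_int_mul_periodic (-k) 0
  simp only [zero_add, Complex.ofReal_zero, mul_zero, Complex.exp_zero, Int.cast_neg, mul_neg,
    neg_mul] at he
  rw [hb, he] at hibp
  simp only [Complex.ofReal_zero, mul_zero, neg_zero, Complex.exp_zero, mul_one, sub_self,
    zero_sub] at hibp
  have h2 : ∫ η in (0 : ℝ)..(2 * Real.pi), h η *
        (Complex.exp (-(Complex.I * (k : ℂ) * (η : ℂ))) * -(Complex.I * k))
      = -(Complex.I * k) * ∫ η in (0 : ℝ)..(2 * Real.pi),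
        h η * Complex.exp (-(Complex.I * (k : ℂ) * (η : ℂ))) := by
    rw [← intervalIntegral.integral_const_mul]
    congr 1
    ext η
    ring
  rw [h2] at hibp
  rw [fourierCoef, fourierCoef]
  linear_combination (1 / (2 * (Real.pi : ℂ))) * hibp

theorem fourierCoef_add {f g : ℝ → ℂ} (hf : Continuous f) (hg : Continuous g) (k : ℤ) :
    fourierCoef (fun η => f η + g η) k = fourierCoef f k + fourierCoef g k := by
  unfold fourierCoef
  rw [← mul_add, ← intervalIntegral.integral_add]
  · simp only [add_mul]
  · exact Continuous.intervalIntegrable (by fun_prop) _ _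
  · exact Continuous.intervalIntegrable (by fun_prop) _ _

theorem fourierCoef_const_mul (c : ℂ) (f : ℝ → ℂ) (k : ℤ) :
    fourierCoef (fun η => c * f η) k = c * fourierCoef f k := by
  unfold fourierCoef
  simp only [mul_assoc, intervalIntegral.integral_const_mul]
  ring

theorem integral_exp_I_mul_int_mul (m : ℤ) :
    ∫ η in (0 : ℝ)..(2 * Real.pi), Complex.exp (Complex.I * (m : ℂ) * (η : ℂ))
      = if m = 0 then 2 * (Real.pi : ℂ) else 0 := by
  split_ifs with hm
  · simp [hm]
  · rw [integral_exp_mul_complex (by simp [hm])]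
    have := exp_I_mul_int_mul_periodic m 0
    rw [zero_add] at this
    rw [this, sub_self, zero_div]

section Series

variable {x : ℤ → ℂ}

theorem hasSum_trigSum (hx : Summable fun k => ‖x k‖) (η : ℝ) :
    HasSum (fun k : ℤ => x k * Complex.exp (Complex.I * (k : ℂ) * (η : ℂ))) (trigSum x η) :=
  (Summable.of_norm_bounded hx fun k => by
    rw [norm_mul, norm_exp_I_mul_int_mul, mul_one]).hasSum

theorem trigSum_periodic (x : ℤ → ℂ) (η : ℝ) : trigSum x (η + 2 * Real.pi) = trigSum x η :=
  tsum_congr fun k => by rw [exp_I_mul_int_mul_periodic]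

theorem continuous_trigSum (hx : Summable fun k => ‖x k‖) : Continuous (trigSum x) :=
  continuous_tsum (fun k => by fun_prop) hx fun k η => by
    rw [norm_mul, norm_exp_I_mul_int_mul, mul_one]

theorem fourierCoef_trigSum (hx : Summable fun k => ‖x k‖) (n : ℤ) :
    fourierCoef (trigSum x) n = x n := by
  have h := intervalIntegral.hasSum_integral_of_dominated_convergence
    (μ := MeasureTheory.volume) (a := 0) (b := 2 * Real.pi)
    (F := fun (k : ℤ) (η : ℝ) => x k * Complex.exp (Complex.I * (k : ℂ) * (η : ℂ)) *
      Complex.exp (-(Complex.I * (n : ℂ) * (η : ℂ))))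
    (f := fun η => trigSum x η * Complex.exp (-(Complex.I * (n : ℂ) * (η : ℂ))))
    (fun k _ => ‖x k‖)
    (fun k => Continuous.aestronglyMeasurable (by fun_prop))
    (fun k => Eventually.of_forall fun η _ => by
      rw [norm_mul, norm_mul, norm_exp_I_mul_int_mul, norm_exp_neg_I_mul_int_mul, mul_one, mul_one])
    (Eventually.of_forall fun η _ => hx)
    intervalIntegrable_const
    (Eventually.of_forall fun η _ => (hasSum_trigSum hx η).mul_right _)
  have h2 : ∀ k : ℤ, ∫ η in (0 : ℝ)..(2 * Real.pi),
      x k * Complex.exp (Complex.I * (k : ℂ) * (η : ℂ)) *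
        Complex.exp (-(Complex.I * (n : ℂ) * (η : ℂ)))
      = if k = n then x n * (2 * (Real.pi : ℂ)) else 0 := by
    intro k
    have h3 := integral_exp_I_mul_int_mul (k - n)
    calc _ = ∫ η in (0 : ℝ)..(2 * Real.pi),
          x k * Complex.exp (Complex.I * ((k - n : ℤ) : ℂ) * (η : ℂ)) := by
          congr 1
          ext η
          rw [mul_assoc, ← Complex.exp_add]
          congr 2
          push_cast
          ring
      _ = _ := by
          rw [intervalIntegral.integral_const_mul, h3]
          by_cases hk : k = n
          · simp [hk]
          · rw [if_neg (sub_ne_zero.2 hk), if_neg hk, mul_zero]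
  simp only [h2] at h
  rw [fourierCoef, h.unique (hasSum_ite_eq n _)]
  have : (Real.pi : ℂ) ≠ 0 := Complex.ofReal_ne_zero.2 Real.pi_ne_zero
  field_simp

/-- A continuous periodic function with summable Fourier coefficients is the sum of its Fourier
series. -/
theorem trigSum_fourierCoef {f : ℝ → ℂ} (hf : Continuous f)
    (hp : ∀ η, f (η + 2 * Real.pi) = f η) (hs : Summable fun k => ‖fourierCoef f k‖) :
    trigSum (fourierCoef f) = f := by
  have : Fact (0 < 2 * Real.pi) := ⟨Real.two_pi_pos⟩
  have hper : Function.Periodic f (2 * Real.pi) := hp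
  let F : C(AddCircle (2 * Real.pi), ℂ) :=
    ⟨hper.lift, continuous_coinduced_dom.mpr hf⟩
  have hexp : ∀ (k : ℤ) (η : ℝ), fourier k (η : AddCircle (2 * Real.pi))
      = Complex.exp (Complex.I * (k : ℂ) * (η : ℂ)) := by
    intro k η
    rw [fourier_coe_apply]
    congr 1
    have : (Real.pi : ℂ) ≠ 0 := Complex.ofReal_ne_zero.2 Real.pi_ne_zero
    push_cast
    field_simp
  have hF : ∀ k, fourierCoeff F k = fourierCoef f k := by
    intro k
    rw [fourierCoeff_eq_intervalIntegral _ _ 0, zero_add, fourierCoef, Complex.real_smul]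
    push_cast
    congr 1
    refine intervalIntegral.integral_congr fun η _ => ?_
    change _ * f η = _
    rw [hexp, mul_comm]
    congr 2
    push_cast
    ring
  have hsum : Summable (fourierCoeff F) := by
    rw [show fourierCoeff F = fourierCoef f from funext hF]
    exact hs.of_norm
  funext η
  have h := has_pointwise_sum_fourier_series_of_summable hsum (η : AddCircle (2 * Real.pi))
  rw [trigSum, ← show F (η : AddCircle (2 * Real.pi)) = f η from rfl, ← h.tsum_eq]
  exact tsum_congr fun k => by rw [hF, hexp, smul_eq_mul]

theorem hasDerivAt_trigSum (hx : Summable fun k => ‖x k‖)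
    (hx' : Summable fun k : ℤ => ‖Complex.I * k * x k‖) (η : ℝ) :
    HasDerivAt (trigSum x) (trigSum (fun k => Complex.I * k * x k) η) η := by
  refine hasDerivAt_tsum (y₀ := (0 : ℝ)) (u := fun k : ℤ => ‖Complex.I * k * x k‖)
    (g := fun (k : ℤ) (η : ℝ) => x k * Complex.exp (Complex.I * (k : ℂ) * (η : ℂ)))
    (g' := fun (k : ℤ) (η : ℝ) => Complex.I * k * x k * Complex.exp (Complex.I * (k : ℂ) * (η : ℂ)))
    hx' (fun k η => ?_) (fun k η => ?_) (hasSum_trigSum hx 0).summable η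
  · have h1 : HasDerivAt (fun η : ℝ => Complex.I * (k : ℂ) * (η : ℂ)) (Complex.I * k * 1) η :=
      (Complex.ofRealCLM.hasDerivAt (x := η)).const_mul (Complex.I * k)
    convert! (h1.cexp).const_mul (x k) using 1
    ring
  · rw [norm_mul, norm_exp_I_mul_int_mul, mul_one]

/-- The discrete convolution of two absolutely summable sequences. -/
def conv (g x : ℤ → ℂ) (n : ℤ) : ℂ := ∑' m, g (n - m) * x m

theorem summable_conv_terms {g : ℤ → ℂ} (hg : Summable fun k => ‖g k‖)
    (hx : Summable fun k => ‖x k‖) :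
    Summable fun p : ℤ × ℤ => ‖g (p.1 - p.2) * x p.2‖ := by
  let e : ℤ × ℤ ≃ ℤ × ℤ :=
    { toFun := fun p => (p.1 - p.2, p.2)
      invFun := fun p => (p.1 + p.2, p.2)
      left_inv := fun p => by ext <;> simp
      right_inv := fun p => by ext <;> simp }
  have h := hg.mul_of_nonneg hx (fun _ => norm_nonneg _) (fun _ => norm_nonneg _)
  refine ((e.summable_iff (f := fun p : ℤ × ℤ => ‖g p.1‖ * ‖x p.2‖)).2 h).congr fun p => ?_
  rw [norm_mul]
  rfl

theorem summable_norm_conv {g : ℤ → ℂ} (hg : Summable fun k => ‖g k‖)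
    (hx : Summable fun k => ‖x k‖) : Summable fun n => ‖conv g x n‖ :=
  Summable.of_nonneg_of_le (fun _ => norm_nonneg _)
    (fun n => norm_tsum_le_tsum_norm ((summable_conv_terms hg hx).prod_factor n))
    (summable_conv_terms hg hx).prod

theorem trigSum_conv {g : ℤ → ℂ} (hg : Summable fun k => ‖g k‖) (hx : Summable fun k => ‖x k‖)
    (η : ℝ) : trigSum (conv g x) η = trigSum g η * trigSum x η := by
  have hT := summable_conv_terms hg hx
  have h1 : Summable fun p : ℤ × ℤ => (g (p.1 - p.2) * x p.2) *
      Complex.exp (Complex.I * (p.1 : ℂ) * (η : ℂ)) :=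
    Summable.of_norm_bounded hT fun p => by rw [norm_mul, norm_exp_I_mul_int_mul, mul_one]
  have h2 : ∑' p : ℤ × ℤ, (g (p.1 - p.2) * x p.2) * Complex.exp (Complex.I * (p.1 : ℂ) * (η : ℂ))
      = trigSum (conv g x) η := by
    rw [h1.tsum_prod]
    exact tsum_congr fun n => by simp only [tsum_mul_right, conv]
  let e : ℤ × ℤ ≃ ℤ × ℤ :=
    { toFun := fun p => (p.1 + p.2, p.2)
      invFun := fun p => (p.1 - p.2, p.2)
      left_inv := fun p => by ext <;> simp
      right_inv := fun p => by ext <;> simp }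
  have h3 := (hasSum_trigSum hg η).summable.norm
  have h4 := (hasSum_trigSum hx η).summable.norm
  rw [← h2, ← e.tsum_eq, trigSum, trigSum, tsum_mul_tsum_of_summable_norm h3 h4]
  refine tsum_congr fun p => ?_
  change (g (p.1 + p.2 - p.2) * x p.2) *
    Complex.exp (Complex.I * ((p.1 + p.2 : ℤ) : ℂ) * (η : ℂ)) = _
  rw [add_sub_cancel_right, Int.cast_add, mul_add, add_mul, Complex.exp_add]
  ring

end Series

/-- The Fourier coefficients of a twice differentiable function decay quadratically. -/
theorem norm_fourierCoef_le_div_sq {h h' h'' : ℝ → ℂ} (hd : ∀ η, HasDerivAt h (h' η) η)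
    (hd' : ∀ η, HasDerivAt h' (h'' η) η) (hc : Continuous h'')
    (hp : ∀ η, h (η + 2 * Real.pi) = h η) (hp' : ∀ η, h' (η + 2 * Real.pi) = h' η)
    {M : ℝ} (hM : ∀ η, ‖h'' η‖ ≤ M) {k : ℤ} (hk : k ≠ 0) :
    ‖fourierCoef h k‖ ≤ M / (k : ℝ) ^ 2 := by
  have hc' : Continuous h' := continuous_iff_continuousAt.2 fun η => (hd' η).continuousAt
  have h1 := norm_fourierCoef_le hM k
  rw [fourierCoef_deriv hd' hc hp', fourierCoef_deriv hd hc' hp, norm_mul, norm_mul, norm_mul,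
    norm_mul, Complex.norm_I, Complex.norm_intCast] at h1
  have hk' : (0 : ℝ) < (k : ℝ) ^ 2 := by
    have : (k : ℝ) ≠ 0 := Int.cast_ne_zero.2 hk
    positivity
  rw [le_div_iff₀ hk', ← sq_abs]
  linarith

theorem summable_ite_div_sq (B M : ℝ) :
    Summable fun k : ℤ => if k = 0 then B else M / (k : ℝ) ^ 2 := by
  have h1 : Summable fun k : ℤ => M * (1 / (k : ℝ) ^ 2) :=
    (Real.summable_one_div_int_pow.2 (show 1 < 2 by norm_num)).mul_left M
  refine (h1.update 0 B).congr fun k => ?_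
  by_cases hk : k = 0
  · simp [hk]
  · simp [hk, div_eq_mul_inv]

theorem exists_bound_of_continuous_of_periodic {h : ℝ → ℂ} (hc : Continuous h)
    (hp : ∀ η, h (η + 2 * Real.pi) = h η) : ∃ M, ∀ η, ‖h η‖ ≤ M := by
  have hper : Function.Periodic h (2 * Real.pi) := hp
  obtain ⟨M, hM⟩ := (isCompact_Icc (a := (0 : ℝ)) (b := 2 * Real.pi)).exists_bound_of_continuousOn
    hc.continuousOn
  refine ⟨M, fun η => ?_⟩
  obtain ⟨y, hy, hy'⟩ := hper.exists_mem_Ico₀ Real.two_pi_pos η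
  rw [hy']
  exact hM y ⟨hy.1, hy.2.le⟩

/-! ### Null vectors of Hill's system and periodic solutions -/

/-- `x` is a nonzero absolutely summable solution of Hill's system with Floquet exponent `μ`. -/
def IsNullSeq (a : ℤ → ℂ) (μ : ℂ) (x : ℤ → ℂ) : Prop :=
  x ≠ 0 ∧ (Summable fun n => ‖x n‖) ∧ ∀ n : ℤ, conv a x n = (n + μ) ^ 2 * x n

theorem nonResonant_I (θ : ℝ) : NonResonant Complex.I θ := by
  have := nonResonant_I_mul (ρ := 1) (μ := (θ : ℂ)) (by simp)
  simpa using this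

theorem sin_pi_mul_ne_zero {w : ℂ} (hw : w.im ≠ 0) : Complex.sin (Real.pi * w) ≠ 0 := by
  rw [Complex.sin_ne_zero_iff]
  intro k hk
  have h := congrArg Complex.im hk
  rw [Complex.im_ofReal_mul, Complex.im_mul_ofReal, Complex.intCast_im, zero_mul] at h
  exact (mul_ne_zero Real.pi_ne_zero hw) h

theorem hillFun_eq_zero_iff {a : ℤ → ℂ} (ha : Summable fun k => ‖a k‖) (θ : ℝ) :
    hillFun a θ = 0 ↔ ∃ x, IsNullSeq a θ x := by
  have h1 : Complex.sin (Real.pi * (Complex.I - θ)) ≠ 0 := sin_pi_mul_ne_zero (by simp)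
  have h2 : Complex.sin (Real.pi * (Complex.I + θ)) ≠ 0 := sin_pi_mul_ne_zero (by simp)
  rw [hillFun_eq ha (nonResonant_I θ), mul_eq_zero, or_iff_right (mul_ne_zero h1 h2),
    infDet_eq_zero_iff (summable_hillKernel ha _ _)]
  refine exists_congr fun x => and_congr_right fun _ => and_congr_right fun hx =>
    forall_congr' fun n => ?_
  have hres := nonResonant_I θ n
  have hs : HasSum (fun m => a (n - m) * x m) (conv a x n) :=
    ((summable_conv_terms ha hx).prod_factor n).of_norm.hasSum
  have hs2 : HasSum (fun m => hillKernel a Complex.I θ n m * x m)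
      ((conv a x n - Complex.I ^ 2 * x n) / (Complex.I ^ 2 - (n + (θ : ℂ)) ^ 2)) := by
    refine ((hs.sub (hasSum_ite_eq n (Complex.I ^ 2 * x n))).div_const _).congr_fun fun m => ?_
    rw [hillKernel]
    by_cases hm : m = n
    · subst hm
      simp only [if_true]
      ring
    · rw [if_neg hm, if_neg (Ne.symm hm)]
      ring
  rw [hs2.tsum_eq]
  constructor
  · intro h
    field_simp at h
    linear_combination h
  · intro h
    rw [h]
    field_simp
    ring

theorem iteratedDeriv_two_eq {f f' f'' : ℝ → ℂ} (hd : ∀ η, HasDerivAt f (f' η) η)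
    (hd' : ∀ η, HasDerivAt f' (f'' η) η) : deriv f = f' ∧ iteratedDeriv 2 f = f'' := by
  have h1 : deriv f = f' := funext fun η => (hd η).deriv
  refine ⟨h1, ?_⟩
  rw [iteratedDeriv_succ, iteratedDeriv_one, h1]
  exact funext fun η => (hd' η).deriv

/-- The equation `f'' + 2iθf' + (Q - d² - θ²) f = 0` has a nonzero periodic solution exactly when
Hill's system for the Fourier coefficients `a` of `Q - d²` has a null vector. -/
theorem exists_periodic_solution_iff {a : ℤ → ℂ} (ha : Summable fun k => ‖a k‖) (θ : ℝ) :
    (∃ f : ℝ → ℂ, f ≠ 0 ∧ ContDiff ℝ 2 f ∧ (∀ η : ℝ, f (η + 2 * Real.pi) = f η) ∧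
      ∀ η : ℝ, iteratedDeriv 2 f η + 2 * Complex.I * (θ : ℂ) * deriv f η
        + (trigSum a η - (θ : ℂ) ^ 2) * f η = 0) ↔ ∃ x, IsNullSeq a θ x := by
  constructor
  · rintro ⟨f, hf0, hf, hp, hode⟩
    have hfd : Differentiable ℝ f := hf.differentiable (by norm_num)
    have hf1 : ContDiff ℝ 1 (deriv f) := by
      have h : ContDiff ℝ (1 + 1) f := by simpa [one_add_one_eq_two] using hf
      exact (contDiff_succ_iff_deriv.1 h).2.2
    have hf1d : Differentiable ℝ (deriv f) := hf1.differentiable (by norm_num)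
    have hf2c : Continuous (deriv (deriv f)) := (contDiff_one_iff_deriv.1 hf1).2
    have hd : ∀ η, HasDerivAt f (deriv f η) η := fun η => (hfd η).hasDerivAt
    have hd' : ∀ η, HasDerivAt (deriv f) (deriv (deriv f) η) η := fun η => (hf1d η).hasDerivAt
    have hit := (iteratedDeriv_two_eq hd hd').2
    have hper : ∀ {g : ℝ → ℂ}, (∀ η, g (η + 2 * Real.pi) = g η) →
        ∀ η, deriv g (η + 2 * Real.pi) = deriv g η := by
      intro g hg η
      rw [← deriv_comp_add_const g (2 * Real.pi) η]
      congr 1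
      exact funext hg
    have hp1 := hper hp
    obtain ⟨M, hM⟩ := exists_bound_of_continuous_of_periodic hf2c (hper hp1)
    have hx : Summable fun k => ‖fourierCoef f k‖ := by
      refine Summable.of_nonneg_of_le (fun _ => norm_nonneg _) (fun k => ?_)
        (summable_ite_div_sq ‖fourierCoef f 0‖ M)
      split_ifs with hk
      · rw [hk]
      · exact norm_fourierCoef_le_div_sq hd hd' hf2c hp hp1 hM hk
    have hsum := trigSum_fourierCoef hfd.continuous hp hx
    refine ⟨fourierCoef f, ?_, hx, fun n => ?_⟩
    · intro h0
      refine hf0 (hsum.symm.trans ?_)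
      rw [h0]
      exact funext fun η => by simp [trigSum]
    · have hconv : fourierCoef (fun η => trigSum a η * f η) n = conv a (fourierCoef f) n := by
        rw [← fourierCoef_trigSum (summable_norm_conv ha hx) n]
        congr 1
        ext η
        rw [trigSum_conv ha hx, hsum]
      have hcont := continuous_trigSum ha
      have hfc := hfd.continuous
      have hf1c := hf1d.continuous
      have heq : (fun η => trigSum a η * f η)
          = fun η => (-1 : ℂ) * deriv (deriv f) η
            + ((-(2 * Complex.I * (θ : ℂ))) * deriv f η + (θ : ℂ) ^ 2 * f η) := by
        ext η
        have := hode η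
        rw [hit] at this
        linear_combination this
      rw [← hconv, heq, fourierCoef_add (by fun_prop) (by fun_prop),
        fourierCoef_add (by fun_prop) (by fun_prop), fourierCoef_const_mul, fourierCoef_const_mul,
        fourierCoef_const_mul, fourierCoef_deriv hd' hf2c hp1, fourierCoef_deriv hd hf1c hp]
      linear_combination (-(n : ℂ) ^ 2 - 2 * (θ : ℂ) * n) * fourierCoef f n * Complex.I_sq
  · rintro ⟨x, hx0, hx, hnull⟩
    have hx2 : Summable fun n : ℤ => ((n : ℝ) ^ 2) * ‖x n‖ := by
      refine Summable.of_nonneg_of_le (fun _ => by positivity) (fun n => ?_)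
        (((summable_norm_conv ha hx).mul_left 2).add (hx.mul_left (2 * θ ^ 2)))
      rw [hnull n, norm_mul, norm_pow, ← mul_assoc, ← add_mul]
      refine mul_le_mul_of_nonneg_right ?_ (norm_nonneg _)
      have : ((n : ℂ) + (θ : ℂ)) = ((n + θ : ℝ) : ℂ) := by push_cast; rfl
      rw [this, Complex.norm_real, Real.norm_eq_abs, sq_abs]
      nlinarith [sq_nonneg ((n : ℝ) + 2 * θ)]
    have hx1' : Summable fun n : ℤ => ‖Complex.I * n * x n‖ := by
      refine Summable.of_nonneg_of_le (fun _ => norm_nonneg _) (fun n => ?_) (hx.add hx2)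
      rw [norm_mul, norm_mul, Complex.norm_I, one_mul, Complex.norm_intCast]
      have h1 : |(n : ℝ)| ≤ 1 + (n : ℝ) ^ 2 := by
        nlinarith [sq_nonneg (|(n : ℝ)| - 1), sq_abs (n : ℝ), abs_nonneg (n : ℝ)]
      calc |(n : ℝ)| * ‖x n‖ ≤ (1 + (n : ℝ) ^ 2) * ‖x n‖ :=
            mul_le_mul_of_nonneg_right h1 (norm_nonneg _)
        _ = _ := by ring
    have hx2' : Summable fun n : ℤ => ‖Complex.I * n * (Complex.I * n * x n)‖ := by
      refine hx2.congr fun n => ?_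
      rw [norm_mul, norm_mul, norm_mul, norm_mul, Complex.norm_I, one_mul,
        Complex.norm_intCast, ← mul_assoc, ← sq, sq_abs]
    have hd := fun η => hasDerivAt_trigSum hx hx1' η
    have hd' := fun η => hasDerivAt_trigSum hx1' hx2' η
    obtain ⟨hder, hit⟩ := iteratedDeriv_two_eq hd hd'
    refine ⟨trigSum x, ?_, ?_, trigSum_periodic x, fun η => ?_⟩
    · intro h0
      refine hx0 (funext fun n => ?_)
      rw [← fourierCoef_trigSum hx n, h0]
      simp [fourierCoef]
    · have h : ContDiff ℝ (1 + 1) (trigSum x) := by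
        rw [contDiff_succ_iff_deriv, hder]
        refine ⟨fun η => (hd η).differentiableAt, by simp, ?_⟩
        rw [contDiff_one_iff_deriv]
        refine ⟨fun η => (hd' η).differentiableAt, ?_⟩
        rw [show deriv _ = _ from funext fun η => (hd' η).deriv]
        exact continuous_trigSum hx2'
      simpa [one_add_one_eq_two] using h
    · rw [hit, hder, sub_mul, ← trigSum_conv ha hx]
      have h0 := hasSum_trigSum hx η
      have h1 := hasSum_trigSum hx1' η
      have h2 := hasSum_trigSum hx2' η
      have h3 := hasSum_trigSum (summable_norm_conv ha hx) η
      have h4 := (h2.add (h1.mul_left (2 * Complex.I * (θ : ℂ)))).add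
        (h3.sub (h0.mul_left ((θ : ℂ) ^ 2)))
      refine h4.unique ?_
      convert! hasSum_zero using 1
      funext n
      rw [hnull n]
      linear_combination ((n : ℂ) ^ 2 + 2 * (θ : ℂ) * n) * x n *
        Complex.exp (Complex.I * (n : ℂ) * (η : ℂ)) * Complex.I_sq

/-! ### The potential and its Fourier coefficients -/

theorem isClosed_contSpectrum : IsClosed contSpectrum :=
  (isCompact_Icc.image Complex.continuous_ofReal).isClosed

theorem neg_sin_mem_contSpectrum (η : ℝ) : -(Real.sin η : ℂ) ∈ contSpectrum :=
  ⟨-Real.sin η, ⟨neg_le_neg (Real.sin_le_one η), neg_le.1 (Real.neg_one_le_sin η)⟩,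
    by push_cast; rfl⟩

/-- A point off the continuous spectrum has a neighbourhood on which the denominators are bounded
below. -/
theorem exists_ball_le_norm_add_sin {c₀ : ℂ} (hc₀ : c₀ ∉ contSpectrum) :
    ∃ δ > 0, ∀ c ∈ Metric.ball c₀ δ, ∀ η : ℝ, δ ≤ ‖c + (Real.sin η : ℂ)‖ := by
  have hne : contSpectrum.Nonempty := ⟨_, neg_sin_mem_contSpectrum 0⟩
  have hpos := (isClosed_contSpectrum.notMem_iff_infDist_pos hne).1 hc₀
  refine ⟨Metric.infDist c₀ contSpectrum / 2, by positivity, fun c hc η => ?_⟩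
  have h1 := Metric.infDist_le_dist_of_mem (x := c₀) (neg_sin_mem_contSpectrum η)
  rw [dist_eq_norm, sub_neg_eq_add] at h1
  rw [mem_ball_iff_norm'] at hc
  have h2 : c₀ + (Real.sin η : ℂ) = (c₀ - c) + (c + (Real.sin η : ℂ)) := by ring
  have h3 := norm_add_le (c₀ - c) (c + (Real.sin η : ℂ))
  rw [← h2] at h3
  linarith

theorem add_sin_ne_zero {c : ℂ} (hc : c ∉ contSpectrum) (η : ℝ) : c + (Real.sin η : ℂ) ≠ 0 := by
  intro h
  exact hc (eq_neg_of_add_eq_zero_left h ▸ neg_sin_mem_contSpectrum η)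

theorem hasDerivAt_ofReal_sin (η : ℝ) :
    HasDerivAt (fun η : ℝ => (Real.sin η : ℂ)) (Real.cos η : ℂ) η :=
  (Real.hasDerivAt_sin η).ofReal_comp

theorem hasDerivAt_ofReal_cos (η : ℝ) :
    HasDerivAt (fun η : ℝ => (Real.cos η : ℂ)) (-(Real.sin η : ℂ)) η := by
  have := (Real.hasDerivAt_cos η).ofReal_comp
  rwa [Complex.ofReal_neg] at this

theorem hasDerivAt_potential {c : ℂ} {η : ℝ} (hη : c + (Real.sin η : ℂ) ≠ 0) :
    HasDerivAt (potential c) (c * (Real.cos η : ℂ) / (c + (Real.sin η : ℂ)) ^ 2) η := by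
  convert! (hasDerivAt_ofReal_sin η).div ((hasDerivAt_ofReal_sin η).const_add c) hη using 1
  ring

theorem hasDerivAt_deriv_potential {c : ℂ} {η : ℝ} (hη : c + (Real.sin η : ℂ) ≠ 0) :
    HasDerivAt (fun η : ℝ => c * (Real.cos η : ℂ) / (c + (Real.sin η : ℂ)) ^ 2)
      (-(c * (Real.sin η : ℂ)) / (c + (Real.sin η : ℂ)) ^ 2
        - 2 * c * (Real.cos η : ℂ) ^ 2 / (c + (Real.sin η : ℂ)) ^ 3) η := by
  convert! ((hasDerivAt_ofReal_cos η).const_mul c).div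
    (((hasDerivAt_ofReal_sin η).const_add c).fun_pow 2) (pow_ne_zero 2 hη) using 1
  field_simp
  ring

theorem continuous_potential {c : ℂ} (hc : c ∉ contSpectrum) : Continuous (potential c) :=
  continuous_iff_continuousAt.2 fun η => (hasDerivAt_potential (add_sin_ne_zero hc η)).continuousAt

theorem potential_periodic (c : ℂ) (η : ℝ) : potential c (η + 2 * Real.pi) = potential c η := by
  rw [potential, potential, Real.sin_add_two_pi]

theorem norm_ofReal_sin_le_one (η : ℝ) : ‖(Real.sin η : ℂ)‖ ≤ 1 := by
  rw [Complex.norm_real]; exact Real.abs_sin_le_one η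

theorem norm_ofReal_cos_le_one (η : ℝ) : ‖(Real.cos η : ℂ)‖ ≤ 1 := by
  rw [Complex.norm_real]; exact Real.abs_cos_le_one η

theorem norm_potential_le {c : ℂ} {δ : ℝ} (hδ : 0 < δ) (h : ∀ η : ℝ, δ ≤ ‖c + (Real.sin η : ℂ)‖)
    (η : ℝ) : ‖potential c η‖ ≤ 1 / δ := by
  rw [potential, norm_div]
  exact div_le_div₀ zero_le_one (norm_ofReal_sin_le_one η) hδ (h η)

/-- The majorant of the Fourier coefficients of `Q`. -/
def coeffBound (δ M : ℝ) (k : ℤ) : ℝ :=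
  if k = 0 then 1 / δ else (M / δ ^ 2 + 2 * M / δ ^ 3) / (k : ℝ) ^ 2

theorem summable_coeffBound (δ M : ℝ) : Summable (coeffBound δ M) := summable_ite_div_sq _ _

theorem norm_coeff_le {c : ℂ} {δ M : ℝ} (hδ : 0 < δ) (h : ∀ η : ℝ, δ ≤ ‖c + (Real.sin η : ℂ)‖)
    (hM : ‖c‖ ≤ M) (k : ℤ) : ‖coeff c k‖ ≤ coeffBound δ M k := by
  have hne : ∀ η : ℝ, c + (Real.sin η : ℂ) ≠ 0 := fun η => norm_pos_iff.1 (hδ.trans_le (h η))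
  have hM0 : 0 ≤ M := (norm_nonneg c).trans hM
  rw [coeffBound]
  split_ifs with hk
  · exact norm_fourierCoef_le (norm_potential_le hδ h) k
  · refine norm_fourierCoef_le_div_sq (fun η => hasDerivAt_potential (hne η))
      (fun η => hasDerivAt_deriv_potential (hne η)) ?_ (potential_periodic c) ?_ (fun η => ?_) hk
    · refine Continuous.sub (Continuous.div (by fun_prop) (by fun_prop) fun η => ?_)
        (Continuous.div (by fun_prop) (by fun_prop) fun η => ?_)
      · exact pow_ne_zero _ (hne η)
      · exact pow_ne_zero _ (hne η)
    · intro η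
      rw [Real.cos_add_two_pi, Real.sin_add_two_pi]
    · refine (norm_sub_le _ _).trans (add_le_add ?_ ?_)
      · rw [norm_div, norm_neg, norm_mul, norm_pow]
        refine div_le_div₀ hM0 ?_ (by positivity) (pow_le_pow_left₀ hδ.le (h η) 2)
        exact (mul_le_of_le_one_right (norm_nonneg _) (norm_ofReal_sin_le_one η)).trans hM
      · rw [norm_div, norm_mul, norm_mul, norm_pow, norm_pow, Complex.norm_ofNat]
        refine div_le_div₀ (by positivity) ?_ (by positivity) (pow_le_pow_left₀ hδ.le (h η) 3)
        refine (mul_le_of_le_one_right (by positivity)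
          (pow_le_one₀ (norm_nonneg _) (norm_ofReal_cos_le_one η))).trans ?_
        linarith

theorem countable_sin_eq_zero : {η : ℝ | Real.sin η = 0}.Countable := by
  have : {η : ℝ | Real.sin η = 0} = Set.range fun n : ℤ => (n : ℝ) * Real.pi := by
    ext η
    exact Real.sin_eq_zero_iff
  rw [this]
  exact Set.countable_range _

/-- For `c = 0` the potential equals `1` off a null set. -/
theorem coeff_zero_eq (k : ℤ) : coeff 0 k = if k = 0 then 1 else 0 := by
  have h1 : ∀ᵐ η : ℝ, η ∈ Set.uIoc 0 (2 * Real.pi) →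
      potential 0 η * Complex.exp (-(Complex.I * (k : ℂ) * (η : ℂ)))
        = Complex.exp (Complex.I * ((-k : ℤ) : ℂ) * (η : ℂ)) := by
    filter_upwards [countable_sin_eq_zero.ae_notMem MeasureTheory.volume] with η hη _
    have : (Real.sin η : ℂ) ≠ 0 := Complex.ofReal_ne_zero.2 hη
    rw [potential, zero_add, div_self this, one_mul]
    congr 1
    push_cast
    ring
  rw [coeff, intervalIntegral.integral_congr_ae h1, integral_exp_I_mul_int_mul]
  have : (Real.pi : ℂ) ≠ 0 := Complex.ofReal_ne_zero.2 Real.pi_ne_zero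
  by_cases hk : k = 0
  · simp only [hk, neg_zero, if_true]
    field_simp
  · simp [hk]

theorem summable_coeff {c : ℂ} (hc : c ∉ contSpectrum ∨ c = 0) :
    Summable fun k => ‖coeff c k‖ := by
  rcases hc with hc | rfl
  · obtain ⟨δ, hδ, h⟩ := exists_ball_le_norm_add_sin hc
    exact Summable.of_nonneg_of_le (fun _ => norm_nonneg _)
      (norm_coeff_le hδ (h c (Metric.mem_ball_self hδ)) le_rfl) (summable_coeffBound δ ‖c‖)
  · refine (hasSum_ite_eq (0 : ℤ) (1 : ℝ)).summable.congr fun k => ?_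
    rw [coeff_zero_eq, apply_ite norm, norm_one, norm_zero]

theorem trigSum_coeff {c : ℂ} (hc : c ∉ contSpectrum ∨ c = 0) {η : ℝ}
    (hη : c + (Real.sin η : ℂ) ≠ 0) : trigSum (coeff c) η = potential c η := by
  rcases hc with hc | rfl
  · exact congrFun (trigSum_fourierCoef (continuous_potential hc) (potential_periodic c)
      (summable_coeff (Or.inl hc))) η
  · rw [zero_add] at hη
    rw [potential, zero_add, div_self hη, trigSum, tsum_eq_single 0]
    · simp [coeff_zero_eq]
    · intro k hk
      rw [coeff_zero_eq, if_neg hk, zero_mul]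

theorem dense_add_sin_ne_zero {c : ℂ} (hc : c ∉ contSpectrum ∨ c = 0) :
    Dense {η : ℝ | c + (Real.sin η : ℂ) ≠ 0} := by
  rcases hc with hc | rfl
  · rw [show {η : ℝ | c + (Real.sin η : ℂ) ≠ 0} = Set.univ from
      Set.eq_univ_of_forall fun η => add_sin_ne_zero hc η]
    exact dense_univ
  · refine (countable_sin_eq_zero.dense_compl ℝ).mono fun η hη => ?_
    rw [Set.mem_ofPred_eq, zero_add]
    exact Complex.ofReal_ne_zero.2 hη

/-- The Fourier coefficients of `Q - g₀ + Λ`. -/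
def symbol (c Λ : ℂ) (k : ℤ) : ℂ := if k = 0 then Λ else coeff c k

theorem symbol_eq (c Λ : ℂ) (k : ℤ) :
    symbol c Λ k = coeff c k + if k = 0 then Λ - coeff c 0 else 0 := by
  rw [symbol]
  split_ifs with hk
  · rw [hk]; ring
  · rw [add_zero]

theorem norm_symbol_le {c Λ : ℂ} {A : ℤ → ℝ} {L : ℝ} (hA : ∀ k, ‖coeff c k‖ ≤ A k)
    (hL : ‖Λ‖ ≤ L) (k : ℤ) : ‖symbol c Λ k‖ ≤ A k + if k = 0 then L else 0 := by
  have h0 : 0 ≤ A k := (norm_nonneg _).trans (hA k)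
  rw [symbol]
  split_ifs with hk
  · linarith
  · rw [add_zero]; exact hA k

theorem summable_symbol {c : ℂ} (hc : c ∉ contSpectrum ∨ c = 0) (Λ : ℂ) :
    Summable fun k => ‖symbol c Λ k‖ :=
  Summable.of_nonneg_of_le (fun _ => norm_nonneg _)
    (norm_symbol_le (fun _ => le_rfl) le_rfl)
    ((summable_coeff hc).add (hasSum_ite_eq (0 : ℤ) ‖Λ‖).summable)

theorem trigSum_symbol {c : ℂ} (hc : c ∉ contSpectrum ∨ c = 0) (Λ : ℂ) (η : ℝ) :
    trigSum (symbol c Λ) η = trigSum (coeff c) η + (Λ - coeff c 0) := by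
  refine HasSum.tsum_eq ?_
  refine ((hasSum_trigSum (summable_coeff hc) η).add
    (hasSum_ite_eq (0 : ℤ) (Λ - coeff c 0))).congr_fun fun k => ?_
  rw [symbol_eq, add_mul]
  congr 1
  by_cases hk : k = 0
  · simp [hk]
  · simp [hk]

/-- The equation, required only where the denominator of `Q` does not vanish, holds everywhere for
the continuous version of `Q` by density; this matters for `c = 0` alone. -/
theorem mem_modeEigenvalues_iff {c : ℂ} (hc : c ∉ contSpectrum ∨ c = 0) (θ d : ℝ) :
    c ∈ modeEigenvalues θ d ↔ hillFun (symbol c (coeff c 0 - (d : ℂ) ^ 2)) θ = 0 := by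
  have hs := summable_symbol hc (coeff c 0 - (d : ℂ) ^ 2)
  rw [hillFun_eq_zero_iff hs, ← exists_periodic_solution_iff hs]
  refine exists_congr fun f => and_congr_right fun _ => and_congr_right fun hf =>
    and_congr_right fun _ => ?_
  have hq : ∀ η : ℝ, c + (Real.sin η : ℂ) ≠ 0 →
      trigSum (symbol c (coeff c 0 - (d : ℂ) ^ 2)) η - (θ : ℂ) ^ 2
        = potential c η - ((θ : ℂ) ^ 2 + (d : ℂ) ^ 2) := by
    intro η hη
    rw [trigSum_symbol hc, trigSum_coeff hc hη]
    ring
  constructor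
  · intro h
    have hcont : Continuous fun η : ℝ => iteratedDeriv 2 f η
        + 2 * Complex.I * (θ : ℂ) * deriv f η
        + (trigSum (symbol c (coeff c 0 - (d : ℂ) ^ 2)) η - (θ : ℂ) ^ 2) * f η := by
      have h0 := hf.continuous
      have h1 := hf.continuous_deriv (by norm_num)
      have h2 := hf.continuous_iteratedDeriv 2 le_rfl
      have h3 := continuous_trigSum hs
      fun_prop
    have := hcont.ext_on (dense_add_sin_ne_zero hc) continuous_const (g := fun _ => (0 : ℂ))
      fun η hη => by simpa only [hq η hη] using h η hη
    exact fun η => congrFun this η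
  · intro h η hη
    rw [← hq η hη]
    exact h η

/-! ### The Hill determinant and the Evans function -/

theorem nonResonant_cpow_half {Λ : ℂ} (hΛ : Λ ∉ squares) : NonResonant (Λ ^ (1 / 2 : ℂ)) 0 := by
  intro n h0
  refine hΛ ⟨n, ?_⟩
  rw [one_div, Complex.cpow_ofNat_inv_pow, add_zero, sub_eq_zero] at h0
  exact h0

theorem det_hillMatrix (c Λ : ℂ) (N : ℕ) :
    (hillMatrix c Λ N).det
      = truncDet (hillKernel (symbol c Λ) (Λ ^ (1 / 2 : ℂ)) 0) (Finset.Icc (-(N : ℤ)) N) := by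
  rw [truncDet]
  congr 1
  ext n m
  rw [Matrix.add_apply, Matrix.one_apply, add_comm, hillMatrix, Matrix.of_apply, Matrix.of_apply,
    hillKernel, one_div, Complex.cpow_ofNat_inv_pow, add_zero, symbol, coeffOff]
  congr 2
  by_cases h : (n : ℤ) = m
  · simp [h]
  · rw [if_neg (sub_ne_zero.2 h), if_neg (sub_ne_zero.2 h), if_neg h, sub_zero]

theorem tendsto_det_hillMatrix {c : ℂ} (hc : c ∉ contSpectrum ∨ c = 0) (Λ : ℂ) :
    Tendsto (fun N : ℕ => (hillMatrix c Λ N).det) atTop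
      (𝓝 (infDet (hillKernel (symbol c Λ) (Λ ^ (1 / 2 : ℂ)) 0))) := by
  simp only [det_hillMatrix]
  exact tendsto_truncDet_hillKernel (summable_symbol hc Λ) _ _

theorem hillDet_eq {c : ℂ} (hc : c ∉ contSpectrum ∨ c = 0) (Λ : ℂ) :
    hillDet c Λ = infDet (hillKernel (symbol c Λ) (Λ ^ (1 / 2 : ℂ)) 0) :=
  (tendsto_det_hillMatrix hc Λ).limUnder_eq

/-- Off the squares `z = √Λ` is admissible, and Hill's matrix has a zero diagonal for this `z`. -/
theorem rawProduct_eq {c : ℂ} (hc : c ∉ contSpectrum ∨ c = 0) {Λ : ℂ} (hΛ : Λ ∉ squares) :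
    rawProduct c Λ = hillFun (symbol c Λ) 0 := by
  rw [rawProduct, hillDet_eq hc, hillFun_eq (summable_symbol hc Λ) (nonResonant_cpow_half hΛ),
    sub_zero, add_zero]
  ring

/-- For real Floquet exponents all resonances are avoided by `z = i`. -/
theorem hillFun_ofReal_eq {a : ℤ → ℂ} (ha : Summable fun k => ‖a k‖) (θ : ℝ) :
    hillFun a θ = Complex.sin (Real.pi * (Complex.I - θ)) *
      Complex.sin (Real.pi * (Complex.I + θ)) * infDet (hillKernel a Complex.I θ) :=
  hillFun_eq ha (nonResonant_I θ)

/-- Holomorphic dependence of the regularised Hill determinant on a parameter of the symbol. -/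
theorem differentiableOn_hillFun_comp {U : Set ℂ} (hU : IsOpen U) {F : ℂ → ℤ → ℂ} {A : ℤ → ℝ}
    (hA : Summable A) (hFA : ∀ w ∈ U, ∀ k, ‖F w k‖ ≤ A k) (hA0 : ∀ k, 0 ≤ A k)
    (hF : ∀ k, DifferentiableOn ℂ (fun w => F w k) U) (θ : ℝ) :
    DifferentiableOn ℂ (fun w => hillFun (F w) θ) U := by
  have h1 : DifferentiableOn ℂ (fun w => infDet (hillKernel (F w) Complex.I θ)) U := by
    refine differentiableOn_infDet hU (fun n m => ?_)
      (hasSum_hillMajorant hA hA0 (summable_inv_divisor Complex.I θ) (fun _ => norm_nonneg _)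
        Complex.I).summable
      (fun w hw n m => norm_hillKernel_le (hFA w hw) (fun _ => le_rfl) n m)
    exact ((hF (n - m)).sub_const _).div_const _
  refine (h1.const_mul (Complex.sin (Real.pi * (Complex.I - θ)) *
    Complex.sin (Real.pi * (Complex.I + θ)))).congr fun w hw => ?_
  exact hillFun_ofReal_eq
    (Summable.of_nonneg_of_le (fun _ => norm_nonneg _) (hFA w hw) hA) θ

theorem differentiable_hillFun_symbol {c : ℂ} (hc : c ∉ contSpectrum ∨ c = 0) (θ : ℝ) :
    Differentiable ℂ fun Λ => hillFun (symbol c Λ) θ := by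
  intro Λ₀
  refine (differentiableOn_hillFun_comp Metric.isOpen_ball (F := symbol c)
    (A := fun k => ‖coeff c k‖ + if k = 0 then ‖Λ₀‖ + 1 else 0)
    ((summable_coeff hc).add (hasSum_ite_eq (0 : ℤ) (‖Λ₀‖ + 1)).summable) (fun Λ hΛ => ?_)
    (fun k => by split_ifs <;> positivity) (fun k => ?_) θ).differentiableAt
    (Metric.ball_mem_nhds Λ₀ one_pos)
  · refine norm_symbol_le (fun _ => le_rfl) ?_
    rw [mem_ball_iff_norm] at hΛ
    have := norm_le_norm_add_norm_sub' Λ Λ₀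
    linarith
  · unfold symbol
    split_ifs
    · exact differentiableOn_id
    · exact differentiableOn_const _

theorem eventually_notMem_squares (Λ : ℂ) : ∀ᶠ w in 𝓝[≠] Λ, w ∉ squares := by
  have hfin : (squares ∩ Metric.ball Λ 1).Finite := by
    obtain ⟨M, hM⟩ := exists_nat_ge (‖Λ‖ + 1)
    refine ((Set.finite_Icc (-(M : ℤ)) M).image fun n : ℤ => (n : ℂ) ^ 2).subset ?_
    rintro w ⟨⟨n, rfl⟩, hw⟩
    refine ⟨n, abs_le.1 ?_, rfl⟩
    rw [mem_ball_iff_norm] at hw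
    have h1 := norm_le_norm_add_norm_sub' ((n : ℂ) ^ 2) Λ
    rw [norm_pow, Complex.norm_intCast] at h1
    have h2 : |(n : ℝ)| ^ 2 ≤ M := by linarith
    have h3 : |n| ^ 2 ≤ (M : ℤ) := by exact_mod_cast h2
    nlinarith [abs_nonneg n]
  have h1 : ∀ᶠ w in 𝓝 Λ, w ∉ (squares ∩ Metric.ball Λ 1) \ {Λ} :=
    (hfin.subset Set.sdiff_subset).isClosed.isOpen_compl.mem_nhds fun h => h.2 rfl
  filter_upwards [nhdsWithin_le_nhds h1, self_mem_nhdsWithin,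
    nhdsWithin_le_nhds (Metric.ball_mem_nhds Λ one_pos)] with w hw hne hball hsq
  exact hw ⟨⟨hsq, hball⟩, hne⟩

/-- The singularities at the squares are removable, because `hillFun` is entire in the mean value of
the potential. -/
theorem tendsto_rawProduct {c : ℂ} (hc : c ∉ contSpectrum ∨ c = 0) (Λ : ℂ) :
    Tendsto (rawProduct c) (𝓝[≠] Λ) (𝓝 (hillFun (symbol c Λ) 0)) := by
  have h := (differentiable_hillFun_symbol hc 0).continuous.tendsto Λ
  rw [Complex.ofReal_zero] at h
  refine (h.mono_left nhdsWithin_le_nhds).congr' ?_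
  filter_upwards [eventually_notMem_squares Λ] with w hw
  exact (rawProduct_eq hc hw).symm

theorem hillProduct_eq {c : ℂ} (hc : c ∉ contSpectrum ∨ c = 0) (Λ : ℂ) :
    hillProduct c Λ = hillFun (symbol c Λ) 0 := by
  rw [hillProduct]
  split_ifs with hΛ
  · exact (tendsto_rawProduct hc Λ).limUnder_eq
  · exact rawProduct_eq hc hΛ

/-- The Evans function at `θ` is Hill's determinant for the Floquet exponent `θ`. -/
theorem evans_eq {c : ℂ} (hc : c ∉ contSpectrum ∨ c = 0) (θ d : ℝ) :
    evans c θ d = 4 * hillFun (symbol c (coeff c 0 - (d : ℂ) ^ 2)) θ := by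
  rw [evans, hillProduct_eq hc, hillFun_eq_sub_sin_sq (summable_symbol hc _) θ]
  have h1 : (Real.cos (2 * Real.pi * θ) : ℂ) = 1 - 2 * Complex.sin (Real.pi * θ) ^ 2 := by
    push_cast
    rw [mul_assoc, Complex.cos_two_mul, Complex.cos_sq']
    ring
  rw [h1]
  ring

theorem evans_eq_zero_iff {c : ℂ} (hc : c ∉ contSpectrum ∨ c = 0) (θ d : ℝ) :
    evans c θ d = 0 ↔ c ∈ modeEigenvalues θ d := by
  rw [evans_eq hc, mem_modeEigenvalues_iff hc, mul_eq_zero, or_iff_right (by norm_num)]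

theorem differentiableOn_coeff {c₀ : ℂ} {δ : ℝ} (hδ : 0 < δ)
    (h : ∀ c ∈ Metric.ball c₀ δ, ∀ η : ℝ, δ ≤ ‖c + (Real.sin η : ℂ)‖) (k : ℤ) :
    DifferentiableOn ℂ (fun c => coeff c k) (Metric.ball c₀ δ) := by
  intro c hc
  have hne : ∀ w ∈ Metric.ball c₀ δ, ∀ η : ℝ, w + (Real.sin η : ℂ) ≠ 0 := fun w hw η =>
    norm_pos_iff.1 (hδ.trans_le (h w hw η))
  have hcont : ∀ w ∈ Metric.ball c₀ δ, Continuous fun η : ℝ =>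
      potential w η * Complex.exp (-(Complex.I * (k : ℂ) * (η : ℂ))) := by
    intro w hw
    have : Continuous (potential w) := continuous_iff_continuousAt.2 fun η =>
      (hasDerivAt_potential (hne w hw η)).continuousAt
    fun_prop
  have hcont' : Continuous fun η : ℝ => -(Real.sin η : ℂ) / (c + (Real.sin η : ℂ)) ^ 2 *
      Complex.exp (-(Complex.I * (k : ℂ) * (η : ℂ))) := by
    refine Continuous.mul (Continuous.div (by fun_prop) (by fun_prop) fun η => ?_) (by fun_prop)
    exact pow_ne_zero 2 (hne c hc η)
  have hI := intervalIntegral.hasDerivAt_integral_of_dominated_loc_of_deriv_le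
    (μ := MeasureTheory.volume) (a := 0) (b := 2 * Real.pi)
    (F := fun (w : ℂ) (η : ℝ) =>
      potential w η * Complex.exp (-(Complex.I * (k : ℂ) * (η : ℂ))))
    (F' := fun (w : ℂ) (η : ℝ) => -(Real.sin η : ℂ) / (w + (Real.sin η : ℂ)) ^ 2 *
      Complex.exp (-(Complex.I * (k : ℂ) * (η : ℂ)))) (bound := fun _ => 1 / δ ^ 2)
    (Metric.isOpen_ball.mem_nhds hc)
    (by
      filter_upwards [Metric.isOpen_ball.mem_nhds hc] with w hw
      exact (hcont w hw).aestronglyMeasurable)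
    ((hcont c hc).intervalIntegrable _ _) hcont'.aestronglyMeasurable
    (Eventually.of_forall fun η _ w hw => by
      rw [norm_mul, norm_exp_neg_I_mul_int_mul, mul_one, norm_div, norm_neg, norm_pow]
      exact div_le_div₀ zero_le_one (norm_ofReal_sin_le_one η) (by positivity)
        (pow_le_pow_left₀ hδ.le (h w hw η) 2))
    intervalIntegrable_const
    (Eventually.of_forall fun η _ w hw => by
      refine HasDerivAt.mul_const ?_ _
      have h1 := (hasDerivAt_const w (Real.sin η : ℂ)).div
        ((hasDerivAt_id w).add_const (Real.sin η : ℂ)) (hne w hw η)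
      convert! h1 using 1
      simp)
  exact (hI.2.const_mul _).differentiableAt.differentiableWithinAt

theorem differentiableOn_evans (θ d : ℝ) :
    DifferentiableOn ℂ (fun c => evans c θ d) contSpectrumᶜ := by
  intro c₀ hc₀
  obtain ⟨δ, hδ, h⟩ := exists_ball_le_norm_add_sin hc₀
  have hball : ∀ c ∈ Metric.ball c₀ δ, c ∉ contSpectrum := by
    rintro c hc ⟨x, hx, rfl⟩
    have h1 := h _ hc (-Real.arcsin x)
    rw [Real.sin_neg, Real.sin_arcsin hx.1 hx.2, Complex.ofReal_neg, add_neg_cancel,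
      norm_zero] at h1
    exact absurd h1 (not_le.2 hδ)
  have hcoeff : ∀ c ∈ Metric.ball c₀ δ, ∀ k, ‖coeff c k‖ ≤ coeffBound δ (‖c₀‖ + δ) k := by
    intro c hc k
    refine norm_coeff_le hδ (h c hc) ?_ k
    rw [mem_ball_iff_norm] at hc
    have := norm_le_norm_add_norm_sub' c c₀
    linarith
  have hA0 : ∀ k, 0 ≤ coeffBound δ (‖c₀‖ + δ) k := fun k =>
    (norm_nonneg _).trans (hcoeff c₀ (Metric.mem_ball_self hδ) k)
  have hL : ∀ c ∈ Metric.ball c₀ δ,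
      ‖coeff c 0 - (d : ℂ) ^ 2‖ ≤ coeffBound δ (‖c₀‖ + δ) 0 + ‖(d : ℂ) ^ 2‖ := fun c hc =>
    (norm_sub_le _ _).trans (add_le_add (hcoeff c hc 0) le_rfl)
  have hD := differentiableOn_hillFun_comp Metric.isOpen_ball
    (F := fun c => symbol c (coeff c 0 - (d : ℂ) ^ 2))
    ((summable_coeffBound δ (‖c₀‖ + δ)).add (hasSum_ite_eq (0 : ℤ)
      (coeffBound δ (‖c₀‖ + δ) 0 + ‖(d : ℂ) ^ 2‖)).summable)
    (fun c hc k => norm_symbol_le (hcoeff c hc) (hL c hc) k)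
    (fun k => add_nonneg (hA0 k) (by
      split_ifs
      · exact add_nonneg (hA0 0) (norm_nonneg _)
      · exact le_rfl)) (fun k => ?_) θ
  · have hE : DifferentiableOn ℂ (fun c => evans c θ d) (Metric.ball c₀ δ) :=
      (hD.const_mul 4).congr fun c hc => evans_eq (Or.inl (hball c hc)) θ d
    exact (hE.differentiableAt (Metric.ball_mem_nhds c₀ hδ)).differentiableWithinAt
  · unfold symbol
    split_ifs
    · exact (differentiableOn_coeff hδ h 0).sub_const _
    · exact differentiableOn_coeff hδ h k

theorem analyticOnNhd_evans (θ d : ℝ) :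
    AnalyticOnNhd ℂ (fun c => evans c θ d) contSpectrumᶜ :=
  (differentiableOn_evans θ d).analyticOnNhd isClosed_contSpectrum.isOpen_compl

theorem norm_le_one_of_mem_contSpectrum {c : ℂ} (hc : c ∈ contSpectrum) : ‖c‖ ≤ 1 := by
  obtain ⟨x, hx, rfl⟩ := hc
  rw [Complex.norm_real]
  exact abs_le.2 hx

/-- Far from the continuous spectrum the potential is too small to produce an eigenvalue. -/
theorem exists_notMem_modeEigenvalues {θ d : ℝ} (hθd : ¬ (d = 0 ∧ ∃ n : ℤ, θ = n)) :
    ∃ c, c ∉ contSpectrum ∧ c ∉ modeEigenvalues θ d := by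
  have hpos : ∀ n : ℤ, 0 < ((n : ℝ) + θ) ^ 2 + d ^ 2 := by
    intro n
    by_contra hn
    have h1 : ((n : ℝ) + θ) ^ 2 = 0 := by nlinarith [sq_nonneg ((n : ℝ) + θ), sq_nonneg d]
    have h2 : d ^ 2 = 0 := by nlinarith [sq_nonneg ((n : ℝ) + θ), sq_nonneg d]
    refine hθd ⟨pow_eq_zero_iff two_ne_zero |>.1 h2, -n, ?_⟩
    have := pow_eq_zero_iff two_ne_zero |>.1 h1
    push_cast
    linarith
  have hsum : Summable fun n : ℤ => (((n : ℝ) + θ) ^ 2 + d ^ 2)⁻¹ := by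
    refine (summable_inv_divisor (Complex.I * d) θ).congr fun n => ?_
    have : (Complex.I * (d : ℂ)) ^ 2 - ((n : ℂ) + θ) ^ 2
        = ((-((n + θ) ^ 2 + d ^ 2) : ℝ) : ℂ) := by
      push_cast
      rw [mul_pow, Complex.I_sq]
      ring
    rw [this, ← Complex.ofReal_inv, Complex.norm_real, inv_neg, norm_neg, Real.norm_eq_abs,
      abs_of_nonneg (inv_nonneg.2 (hpos n).le)]
  set S := ∑' n : ℤ, (((n : ℝ) + θ) ^ 2 + d ^ 2)⁻¹ with hS
  have hS0 : 0 ≤ S := tsum_nonneg fun n => inv_nonneg.2 (hpos n).le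
  refine ⟨((S + 2 : ℝ) : ℂ), fun h => ?_, fun h => ?_⟩
  · have := norm_le_one_of_mem_contSpectrum h
    rw [Complex.norm_real, Real.norm_of_nonneg (by linarith)] at this
    linarith
  · set c : ℂ := ((S + 2 : ℝ) : ℂ) with hcdef
    have hlow : ∀ η : ℝ, S + 1 ≤ ‖c + (Real.sin η : ℂ)‖ := by
      intro η
      rw [hcdef, ← Complex.ofReal_add, Complex.norm_real]
      have := Real.neg_one_le_sin η
      exact le_trans (by linarith) (le_abs_self _)
    have hc : c ∉ contSpectrum := by
      rintro ⟨x, hx, hxc⟩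
      have := norm_le_one_of_mem_contSpectrum ⟨x, hx, hxc⟩
      rw [hcdef, Complex.norm_real, Real.norm_of_nonneg (by linarith)] at this
      linarith
    have hs := summable_symbol (Or.inl hc) (coeff c 0 - (d : ℂ) ^ 2)
    rw [mem_modeEigenvalues_iff (Or.inl hc), hillFun_eq_zero_iff hs] at h
    obtain ⟨x, hx0, hx, hnull⟩ := h
    have hg := summable_coeff (Or.inl hc)
    set X := ∑' n, ‖x n‖ with hX
    have hXpos : 0 < X := by
      obtain ⟨n, hn⟩ := Function.ne_iff.1 hx0
      exact hx.tsum_pos (fun _ => norm_nonneg _) n (norm_pos_iff.2 hn)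
    have hf : ∀ η, ‖trigSum x η‖ ≤ X := fun η =>
      (norm_tsum_le_tsum_norm (hasSum_trigSum hx η).summable.norm).trans
        (le_of_eq (tsum_congr fun n => by rw [norm_mul, norm_exp_I_mul_int_mul, mul_one]))
    have hconv : ∀ n, ‖conv (coeff c) x n‖ ≤ 1 / (S + 1) * X := by
      intro n
      rw [← fourierCoef_trigSum (summable_norm_conv hg hx) n]
      refine norm_fourierCoef_le (fun η => ?_) n
      rw [trigSum_conv hg hx, norm_mul, trigSum_coeff (Or.inl hc) (add_sin_ne_zero hc η)]
      exact mul_le_mul (norm_potential_le (by linarith) hlow η) (hf η) (norm_nonneg _)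
        (by positivity)
    have hrow : ∀ n, ‖x n‖ ≤ (((n : ℝ) + θ) ^ 2 + d ^ 2)⁻¹ * (1 / (S + 1) * X) := by
      intro n
      have h1 : conv (symbol c (coeff c 0 - (d : ℂ) ^ 2)) x n
          = conv (coeff c) x n - (d : ℂ) ^ 2 * x n := by
        refine HasSum.tsum_eq ?_
        have h2 := ((summable_conv_terms hg hx).prod_factor n).of_norm.hasSum
        refine (h2.sub (hasSum_ite_eq n ((d : ℂ) ^ 2 * x n))).congr_fun fun m => ?_
        simp only [symbol_eq]
        by_cases hm : m = n
        · subst hm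
          simp only [sub_self, if_true]
          ring
        · rw [if_neg (sub_ne_zero.2 (Ne.symm hm)), if_neg hm]
          ring
      have h3 : conv (coeff c) x n = ((((n : ℝ) + θ) ^ 2 + d ^ 2 : ℝ) : ℂ) * x n := by
        have := hnull n
        rw [h1] at this
        push_cast
        linear_combination this
      have h4 := hconv n
      rw [h3, norm_mul, Complex.norm_real, Real.norm_of_nonneg (hpos n).le] at h4
      rw [← div_eq_inv_mul, le_div_iff₀ (hpos n), mul_comm]
      exact h4
    have hle : X ≤ S * (1 / (S + 1) * X) := by
      rw [hX, hS, ← tsum_mul_right]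
      exact hx.tsum_le_tsum hrow (hsum.mul_right _)
    have : S * (1 / (S + 1) * X) < X := by
      rw [one_div, ← div_eq_inv_mul, ← mul_div_assoc, div_lt_iff₀ (by linarith)]
      nlinarith
    linarith

theorem isPreconnected_compl_contSpectrum : IsPreconnected contSpectrumᶜ := by
  have hset : contSpectrumᶜ =
      {z : ℂ | 0 < z.im} ∪ {z : ℂ | 1 < z.re} ∪ {z : ℂ | z.im < 0} ∪ {z : ℂ | z.re < -1} := by
    ext z
    simp only [contSpectrum, Set.mem_compl_iff, Set.mem_image, Set.mem_Icc, Set.mem_union,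
      Set.mem_ofPred_eq]
    constructor
    · intro h
      by_contra hcon
      push Not at hcon
      obtain ⟨⟨⟨h1, h2⟩, h3⟩, h4⟩ := hcon
      exact h ⟨z.re, ⟨h4, h2⟩, Complex.ext rfl (le_antisymm h3 h1)⟩
    · rintro h ⟨x, ⟨h1, h2⟩, rfl⟩
      simp only [Complex.ofReal_im, Complex.ofReal_re, lt_irrefl, false_or, or_false] at h
      rcases h with h | h <;> linarith
  rw [hset]
  have hA := (convex_halfSpace_im_gt 0).isPreconnected
  have hB := (convex_halfSpace_re_gt 1).isPreconnected
  have hC := (convex_halfSpace_im_lt 0).isPreconnected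
  have hD := (convex_halfSpace_re_lt (-1)).isPreconnected
  refine IsPreconnected.union' ⟨⟨-2, 1⟩, ?_, ?_⟩ (IsPreconnected.union' ⟨⟨2, -1⟩, ?_, ?_⟩
    (IsPreconnected.union' ⟨⟨2, 1⟩, ?_, ?_⟩ hA hB) hC) hD <;> norm_num

/-- If the Evans function does not vanish identically, its zeros are isolated eigenvalues. -/
theorem evans_eq_zero_iff_isolated {θ d : ℝ} (hθd : ¬ (d = 0 ∧ ∃ n : ℤ, θ = n)) {c : ℂ}
    (hc : c ∉ contSpectrum) :
    evans c θ d = 0 ↔ IsIsolatedPoint (modeEigenvalues θ d) c := by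
  rw [IsIsolatedPoint, ← evans_eq_zero_iff (Or.inl hc), iff_self_and]
  intro h0
  have hopen : ∀ᶠ w in 𝓝[≠] c, w ∉ contSpectrum :=
    nhdsWithin_le_nhds (isClosed_contSpectrum.isOpen_compl.mem_nhds hc)
  by_contra hcon
  obtain ⟨w, hw, hwE⟩ := exists_notMem_modeEigenvalues hθd
  refine hwE ((evans_eq_zero_iff (Or.inl hw) θ d).1 ?_)
  refine (analyticOnNhd_evans θ d).eqOn_zero_of_preconnected_of_frequently_eq_zero
    isPreconnected_compl_contSpectrum hc ?_ hw
  have hfreq : ∃ᶠ w in 𝓝[≠] c, w ∈ modeEigenvalues θ d := fun h => hcon h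
  exact (hfreq.and_eventually hopen).mono fun w hw => (evans_eq_zero_iff (Or.inl hw.2) θ d).2 hw.1

/-! ### The original variables -/

theorem iteratedDeriv_three_cos : iteratedDeriv 3 Real.cos = Real.sin := by
  rw [iteratedDeriv_succ, iteratedDeriv_succ, iteratedDeriv_one, Real.deriv_cos']
  have h1 : deriv (fun x : ℝ => -Real.sin x) = fun x => -Real.cos x := by
    ext x
    rw [deriv.fun_neg, Real.deriv_sin]
  rw [h1]
  ext x
  rw [deriv.fun_neg, Real.deriv_cos, neg_neg]

theorem sq_add_sq_ne_zero_of_det {p₁ p₂ q₁ q₂ : ℤ} (h : p₂ * q₁ - p₁ * q₂ = 1) :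
    (p₁ : ℝ) ^ 2 + (p₂ : ℝ) ^ 2 ≠ 0 := by
  intro h0
  have h1 : p₁ ^ 2 + p₂ ^ 2 = 0 := by exact_mod_cast h0
  have h2 : p₁ = 0 := by nlinarith [sq_nonneg p₁, sq_nonneg p₂]
  have h3 : p₂ = 0 := by nlinarith [sq_nonneg p₁, sq_nonneg p₂]
  simp [h2, h3] at h

/-- The substitution `c = iλ/k`, `θ = k p·q/p²`, `d = k/p²` turns the separated equation into its
normal form, because `p² q² = (p·q)² + 1` for a unimodular pair. -/
theorem mem_separatedEigenvalues_iff {p₁ p₂ q₁ q₂ k : ℤ} (h : p₂ * q₁ - p₁ * q₂ = 1)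
    (hk : k ≠ 0) (lam : ℂ) :
    lam ∈ separatedEigenvalues Real.cos p₁ p₂ q₁ q₂ k ↔
      Complex.I * lam / (k : ℂ) ∈ modeEigenvalues
        ((k : ℝ) * ((p₁ : ℝ) * q₁ + (p₂ : ℝ) * q₂) / ((p₁ : ℝ) ^ 2 + (p₂ : ℝ) ^ 2))
        ((k : ℝ) / ((p₁ : ℝ) ^ 2 + (p₂ : ℝ) ^ 2)) := by
  have hkC : (k : ℂ) ≠ 0 := Int.cast_ne_zero.2 hk
  have hP : (p₁ : ℂ) ^ 2 + (p₂ : ℂ) ^ 2 ≠ 0 := by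
    exact_mod_cast sq_add_sq_ne_zero_of_det h
  have hdet : (p₂ : ℂ) * q₁ - p₁ * q₂ = 1 := by exact_mod_cast h
  have hden : ∀ η : ℝ, Complex.I * lam - (k : ℂ) * ((deriv Real.cos η : ℝ) : ℂ)
      = k * (Complex.I * lam / (k : ℂ) + (Real.sin η : ℂ)) := by
    intro η
    rw [Real.deriv_cos, mul_add, mul_div_cancel₀ _ hkC]
    push_cast
    ring
  have hquad : (k : ℂ) ^ 2 * ((q₁ : ℂ) ^ 2 + (q₂ : ℂ) ^ 2) / ((p₁ : ℂ) ^ 2 + (p₂ : ℂ) ^ 2)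
      = ((k : ℂ) * ((p₁ : ℂ) * q₁ + (p₂ : ℂ) * q₂) / ((p₁ : ℂ) ^ 2 + (p₂ : ℂ) ^ 2)) ^ 2
        + ((k : ℂ) / ((p₁ : ℂ) ^ 2 + (p₂ : ℂ) ^ 2)) ^ 2 := by
    field_simp
    linear_combination ((p₂ : ℂ) * q₁ - p₁ * q₂ + 1) * hdet
  refine exists_congr fun f => and_congr_right fun _ => ?_
  refine and_congr_right fun _ => and_congr_right fun _ => forall_congr' fun η => ?_
  rw [hden, iteratedDeriv_three_cos, hquad, mul_ne_zero_iff, and_iff_right hkC,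
    mul_div_mul_left _ _ hkC]
  refine imp_congr_right fun _ => ?_
  rw [potential]
  push_cast
  rw [mul_assoc (2 * Complex.I) (k : ℂ), mul_div_assoc (2 * Complex.I)]

theorem isIsolatedPoint_separatedEigenvalues_iff {p₁ p₂ q₁ q₂ k : ℤ}
    (h : p₂ * q₁ - p₁ * q₂ = 1) (hk : k ≠ 0) (lam : ℂ) :
    IsIsolatedPoint (separatedEigenvalues Real.cos p₁ p₂ q₁ q₂ k) lam ↔
      IsIsolatedPoint (modeEigenvalues
        ((k : ℝ) * ((p₁ : ℝ) * q₁ + (p₂ : ℝ) * q₂) / ((p₁ : ℝ) ^ 2 + (p₂ : ℝ) ^ 2))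
        ((k : ℝ) / ((p₁ : ℝ) ^ 2 + (p₂ : ℝ) ^ 2))) (Complex.I * lam / (k : ℂ)) := by
  have hkC : (k : ℂ) ≠ 0 := Int.cast_ne_zero.2 hk
  have hne : Complex.I / (k : ℂ) ≠ 0 := div_ne_zero Complex.I_ne_zero hkC
  have hmap := (Homeomorph.mulLeft₀ (Complex.I / (k : ℂ)) hne).map_punctured_nhds_eq lam
  have happ : ∀ w : ℂ, (Homeomorph.mulLeft₀ (Complex.I / (k : ℂ)) hne) w
      = Complex.I * w / (k : ℂ) := fun w => by
    rw [Homeomorph.coe_mulLeft₀]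
    exact div_mul_eq_mul_div _ _ _
  rw [happ] at hmap
  rw [IsIsolatedPoint, IsIsolatedPoint, mem_separatedEigenvalues_iff h hk, ← hmap, eventually_map]
  simp only [happ, mem_separatedEigenvalues_iff h hk]

end EulerHill

end

theorem mainTheorem4 :
    -- the Hill determinant converges, and the singularities of `D(Λ) sin²(π √Λ)` are removable
    (∀ c : ℂ, (c ∉ EulerHill.contSpectrum ∨ c = 0) →
      (∀ Λ : ℂ, Λ ∉ EulerHill.squares →
        Tendsto (fun N : ℕ => (EulerHill.hillMatrix c Λ N).det) atTop
          (𝓝 (EulerHill.hillDet c Λ))) ∧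
      (∀ Λ : ℂ, Λ ∈ EulerHill.squares →
        Tendsto (EulerHill.rawProduct c) (𝓝[≠] Λ) (𝓝 (EulerHill.hillProduct c Λ)))) ∧
    -- `E` is an Evans function for the separated ODE with parameters `(θ, d)`
    (∀ θ d : ℝ,
      AnalyticOnNhd ℂ (fun c => EulerHill.evans c θ d) EulerHill.contSpectrumᶜ ∧
      (∀ c : ℂ, (c ∉ EulerHill.contSpectrum ∨ c = 0) →
        (EulerHill.evans c θ d = 0 ↔ c ∈ EulerHill.modeEigenvalues θ d)) ∧
      (¬ (d = 0 ∧ ∃ n : ℤ, θ = n) →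
        ∀ c : ℂ, c ∉ EulerHill.contSpectrum →
          (EulerHill.evans c θ d = 0 ↔ EulerHill.IsDiscreteEigenvalue θ d c))) ∧
    -- the same in the original variables of the separated linearised Euler equations
    (∀ p₁ p₂ q₁ q₂ k : ℤ, p₂ * q₁ - p₁ * q₂ = 1 → k ≠ 0 →
      ∀ lam : ℂ, Complex.I * lam / (k : ℂ) ∉ EulerHill.contSpectrum →
        (EulerHill.evans (Complex.I * lam / (k : ℂ))
            ((k : ℝ) * ((p₁ : ℝ) * q₁ + (p₂ : ℝ) * q₂) / ((p₁ : ℝ) ^ 2 + (p₂ : ℝ) ^ 2))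
            ((k : ℝ) / ((p₁ : ℝ) ^ 2 + (p₂ : ℝ) ^ 2)) = 0 ↔
          EulerHill.IsIsolatedPoint
            (EulerHill.separatedEigenvalues Real.cos p₁ p₂ q₁ q₂ k) lam)) := by
  refine ⟨fun c hc => ⟨fun Λ _ => ?_, fun Λ _ => ?_⟩, fun θ d =>
    ⟨EulerHill.analyticOnNhd_evans θ d, fun c hc => EulerHill.evans_eq_zero_iff hc θ d,
      fun hθd c hc => ?_⟩, fun p₁ p₂ q₁ q₂ k h hk lam hlam => ?_⟩
  · rw [EulerHill.hillDet_eq hc]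
    exact EulerHill.tendsto_det_hillMatrix hc Λ
  · rw [EulerHill.hillProduct_eq hc]
    exact EulerHill.tendsto_rawProduct hc Λ
  · rw [EulerHill.evans_eq_zero_iff_isolated hθd hc, EulerHill.IsDiscreteEigenvalue,
      and_iff_right hc]
  · rw [EulerHill.isIsolatedPoint_separatedEigenvalues_iff h hk]
    refine EulerHill.evans_eq_zero_iff_isolated (fun h0 => ?_) hlam
    exact div_ne_zero (Int.cast_ne_zero.2 hk) (EulerHill.sq_add_sq_ne_zero_of_det h) h0.1
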